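/- **Theorem (proof-of-stake pool attack).** Let $n\ge 1$ and $\epsilon=\frac1{2n+1}$. For $q,p\in\mathbb R$ let $F_{q,p}$ be the cumulative distribution function of an arbitrary probability law $\mu_{q,p}$ on $\mathbb R$ (the law of the amount of signatures that an announced block receives from the independent miners, when these own the stake $q$ and the connectivity parameter is $p$); in particular, $\mu_{q,p}$ may be the Poisson law with parameter $qp$. Consider the following concurrent stochastic game between two pools $A$ (Player 1) and $B$ (Player 2). *States.* $S=\{1,\dots,n\}^2\times\{0,0.01,\dots,1\}$; in the state $(i,j,p)$ pool $A$ has stake $i\epsilon$, pool $B$ has stake $j\epsilon$, independent miners have stake $1-i\epsilon-j\epsilon$, and $p$ is the connectivity parameter. *Actions.* In every state each pool chooses, simultaneously and independently, to sign the blocks of the other pool or to refrain. *Revenues.* The revenue of a pool with stake $x$, when the other pool has stake $y$, is $R_1+R_2+R_3$. Here $R_1=10x\cdot\rho$, where $\rho=1$ if $x\ge\frac12$, or if the other pool signs and $x+y\ge\frac12$; if $x<\frac12$ and the other pool refrains, $\rho=1-F_{1-x-y,p}(\frac12-x)$; and if the other pool signs and $x+y<\frac12$, $\rho=1-F_{1-x-y,p}(\frac12-x-y)$.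 Further $R_2=xy$ if the pool itself signs and $R_2=0$ if it refrains, and $R_3=x(1-y)$. Let $R_A$ and $R_B$ be the revenues of $A$ (with $x=i\epsilon$, $y=j\epsilon$) and of $B$ (with $x=j\epsilon$, $y=i\epsilon$), as functions of the state and the two actions. *Transitions.* The attractiveness of $A$ is $R_A/(i\epsilon)$ and that of $B$ is $R_B/(j\epsilon)$. A pool that is most attractive (at least as attractive as the other) gains $\epsilon$ stake with probability $\frac23$, and keeps its stake or loses $\epsilon$ with probability $\frac16$ each; otherwise it loses $\epsilon$ with probability $\frac23$, and keeps its stake or gains $\epsilon$ with probability $\frac16$ each. A change that would leave $\{\epsilon,\dots,n\epsilon\}$ is replaced by keeping the stake. The new value of $p$ is uniform on the current value and its neighbours in the grid. Given the state and the actions, the three changes are independent. Strategies are randomized and may depend on the whole history. Then: 1. The game is ergodic: for all states $s,t$ and all strategies $\sigma_A,\sigma_B$, the play from $s$ almost surely visits $t$ infinitely often. 2. There is a real number $v$ that is the value, at every state $s$, of the mean-payoff game in which $A$ maximizes the reward $R_A$ against $B$: $$\sup_{\sigma_A}\inf_{\sigma_B}\mathbb E_s^{\sigma_A,\sigma_B}\Big[\liminf_{T\to\infty}\frac1T\sum_{k<T}R_A^{(k)}\Big]=v=\inf_{\sigma_B}\sup_{\sigma_A}\mathbb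 E_s^{\sigma_A,\sigma_B}\Big[\limsup_{T\to\infty}\frac1T\sum_{k<T}R_A^{(k)}\Big],$$ where $R^{(k)}$ is the reward of round $k$. The number $v$ is also the value, at every state, of the mean-payoff game on the same arena in which $B$ maximizes $R_B$ against $A$. 3. Pool $B$ can ensure an average revenue of $v$ against any behaviour of $A$: there is a strategy $\sigma_B$ such that for all strategies $\sigma_A$ of $A$ and all states $s$, $$\mathbb E_s^{\sigma_A,\sigma_B}\Big[\liminf_{T\to\infty}\frac1T\sum_{k<T}R_B^{(k)}\Big]\ge v.$$ -/

import Mathlib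

open MeasureTheory ProbabilityTheory Filter
open scoped ENNReal NNReal

noncomputable section

namespace ConcurrentGame

/-- A concurrent stochastic game structure with state space `S` and set of moves `Act`: the
non-empty sets of moves available to the two players in each state, and the law of the successor
state. (Finiteness of `S` and `Act` is assumed where the structure is used.) -/
structure GameStructure (S Act : Type*) where
  /-- the moves available to Player 1 -/
  moves₁ : S → Finset Act
  /-- the moves available to Player 2 -/
  moves₂ : S → Finset Act
  moves₁_nonempty : ∀ s, (moves₁ s).Nonempty
  moves₂_nonempty : ∀ s, (moves₂ s).Nonempty
  /-- the law of the successor state -/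
  trans : S → Act → Act → PMF S

/-- A (randomized, history-dependent) strategy for a player whose available moves are `moves`:
to every finite history, of any length `k`, and every current state it assigns a probability
distribution on moves that is supported on the moves available in the current state. -/
structure Strategy {S Act : Type*} (moves : S → Finset Act) where
  /-- the distribution of the next move -/
  move : (k : ℕ) → (Fin k → S × Act × Act) → S → PMF Act
  legal : ∀ k h s, (move k h s).support ⊆ (moves s : Set Act)

namespace GameStructure

variable {S Act : Type*}

/-- Strategies of Player 1. -/
abbrev Strategy₁ (G : GameStructure S Act) : Type _ := Strategy G.moves₁

/-- Strategies of Player 2. -/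
abbrev Strategy₂ (G : GameStructure S Act) : Type _ := Strategy G.moves₂

/-- One round: after the history `h` of length `k`, in the current state `s`, the two players
choose their moves simultaneously and independently. -/
def turn (G : GameStructure S Act) (σ₁ : G.Strategy₁) (σ₂ : G.Strategy₂) (k : ℕ)
    (h : Fin k → S × Act × Act) (s : S) : PMF (S × Act × Act) :=
  (σ₁.move k h s).bind fun a => (σ₂.move k h s).map fun b => (s, a, b)

/-- The law of the round with index `k + 1`, given the rounds with indices `0, …, k`. -/
def nextRound (G : GameStructure S Act) (σ₁ : G.Strategy₁) (σ₂ : G.Strategy₂) (k : ℕ)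
    (h : Fin (k + 1) → S × Act × Act) : PMF (S × Act × Act) :=
  (G.trans (h (Fin.last k)).1 (h (Fin.last k)).2.1 (h (Fin.last k)).2.2).bind
    fun s => G.turn σ₁ σ₂ (k + 1) h s

variable [Finite S] [MeasurableSpace S] [MeasurableSingletonClass S]
  [Finite Act] [MeasurableSpace Act] [MeasurableSingletonClass Act]

/-- `nextRound` as a Markov kernel. -/
def roundKernel (G : GameStructure S Act) (σ₁ : G.Strategy₁) (σ₂ : G.Strategy₂) (k : ℕ) :
    Kernel ((i : Finset.Iic k) → (fun _ : ℕ => S × Act × Act) i) (S × Act × Act) :=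
  Kernel.ofFunOfCountable fun x =>
    (G.nextRound σ₁ σ₂ k fun i =>
      x ⟨i.1, Finset.mem_Iic.2 (Nat.lt_succ_iff.1 i.2)⟩).toMeasure

instance (G : GameStructure S Act) (σ₁ : G.Strategy₁) (σ₂ : G.Strategy₂) (k : ℕ) :
    IsMarkovKernel (G.roundKernel σ₁ σ₂ k) :=
  ⟨fun _ => by
    simp only [roundKernel, Kernel.ofFunOfCountable, Kernel.coe_mk]
    infer_instance⟩

/-- The law of the play `(s₀, a₀, b₀), (s₁, a₁, b₁), …` that starts in `s` when the players use
the strategies `σ₁` and `σ₂`. -/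
def playMeasure (G : GameStructure S Act) (σ₁ : G.Strategy₁) (σ₂ : G.Strategy₂) (s : S) :
    Measure (ℕ → S × Act × Act) :=
  Kernel.trajMeasure (X := fun _ => S × Act × Act)
    (G.turn σ₁ σ₂ 0 Fin.elim0 s).toMeasure (G.roundKernel σ₁ σ₂)

/-- A game is ergodic if, for all states `s`, `t` and all strategy profiles, the play that starts
in `s` almost surely visits `t` infinitely often. -/
def IsErgodic (G : GameStructure S Act) : Prop :=
  ∀ (s t : S) (σ₁ : G.Strategy₁) (σ₂ : G.Strategy₂),
    ∀ᵐ ω ∂(G.playMeasure σ₁ σ₂ s), ∃ᶠ k in atTop, (ω k).1 = t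

/-- The average of the reward `r` over the first `T` rounds of a play. -/
def avg (r : S → Act → Act → ℝ) (T : ℕ) (ω : ℕ → S × Act × Act) : ℝ :=
  (1 / (T : ℝ)) * ∑ i ∈ Finset.range T, r (ω i).1 (ω i).2.1 (ω i).2.2

/-- The limit-inferior average of the reward along a play. -/
def limInfAvg (r : S → Act → Act → ℝ) (ω : ℕ → S × Act × Act) : ℝ :=
  liminf (fun T => avg r T ω) atTop

/-- The limit-superior average of the reward along a play. -/
def limSupAvg (r : S → Act → Act → ℝ) (ω : ℕ → S × Act × Act) : ℝ :=
  limsup (fun T => avg r T ω) atTop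

/-- The expected limit-inferior average. -/
def expLimInfAvg (G : GameStructure S Act) (r : S → Act → Act → ℝ)
    (σ₁ : G.Strategy₁) (σ₂ : G.Strategy₂) (s : S) : ℝ :=
  ∫ ω, limInfAvg r ω ∂(G.playMeasure σ₁ σ₂ s)

/-- The expected limit-superior average. -/
def expLimSupAvg (G : GameStructure S Act) (r : S → Act → Act → ℝ)
    (σ₁ : G.Strategy₁) (σ₂ : G.Strategy₂) (s : S) : ℝ :=
  ∫ ω, limSupAvg r ω ∂(G.playMeasure σ₁ σ₂ s)

/-- The lower value of the mean-payoff game with reward `r` (Player 1 maximizes). -/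
def lowerValue (G : GameStructure S Act) (r : S → Act → Act → ℝ) (s : S) : ℝ :=
  ⨆ σ₁ : G.Strategy₁, ⨅ σ₂ : G.Strategy₂, G.expLimInfAvg r σ₁ σ₂ s

/-- The upper value of the mean-payoff game with reward `r` (Player 2 minimizes). -/
def upperValue (G : GameStructure S Act) (r : S → Act → Act → ℝ) (s : S) : ℝ :=
  ⨅ σ₂ : G.Strategy₂, ⨆ σ₁ : G.Strategy₁, G.expLimSupAvg r σ₁ σ₂ s

/-- The mean-payoff game with reward `r` has the value `v` at `s`: its lower and upper values
coincide and are equal to `v`. -/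
def HasValue (G : GameStructure S Act) (r : S → Act → Act → ℝ) (s : S) (v : ℝ) : Prop :=
  G.lowerValue r s = v ∧ G.upperValue r s = v

end GameStructure

end ConcurrentGame

namespace ProofOfStake

open ConcurrentGame

/-- The two choices of a pool: to sign a block mined by the other pool, or to refrain. -/
inductive Move
  | sign
  | refrain
  deriving DecidableEq

instance : Fintype Move := ⟨{Move.sign, Move.refrain}, fun x => by cases x <;> decide⟩

instance : MeasurableSpace Move := ⊤

instance : MeasurableSingletonClass Move := ⟨fun _ => trivial⟩

/-- A state `(i, j, k)` is the situation in which pool `A` has stake `(i + 1) * ε`, pool `B` has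
stake `(j + 1) * ε` and the connectivity parameter is `k / 100`. -/
abbrev State (n : ℕ) : Type := Fin n × Fin n × Fin 101

/-- The unit of stake. -/
def ε (n : ℕ) : ℝ := 1 / (2 * (n : ℝ) + 1)

/-- The stake of a pool with index `i`. -/
def stake {n : ℕ} (i : Fin n) : ℝ := ((i : ℕ) + 1 : ℝ) * ε n

/-- The connectivity parameter, one of `0, 0.01, …, 1`. -/
def connectivity (k : Fin 101) : ℝ := ((k : ℕ) : ℝ) / 100

/-- A signature law assigns to the total stake `q` of the independent miners and to the
connectivity parameter `p` the law of the amount of independent signatures that an announced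
block receives. -/
abbrev SignatureLaw : Type := ℝ → ℝ → ProbabilityMeasure ℝ

/-- The Poisson instance: the number of independent signatures is Poisson distributed with
parameter `q * p`. -/
def poissonSignatures : SignatureLaw := fun q p =>
  ⟨(poissonMeasure (Real.toNNReal (q * p))).map (Nat.cast : ℕ → ℝ),
    Measure.isProbabilityMeasure_map (measurable_of_countable _).aemeasurable⟩

/-- The expected mining revenue of a pool with stake `x`, when the other pool has stake `y` and
makes the choice `b` about the blocks of this pool. The mining reward of a block is 10 units. -/
def miningRevenue (law : SignatureLaw) (x y p : ℝ) (b : Move) : ℝ :=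
  10 * x *
    (if 1 / 2 ≤ x then 1
     else match b with
      | Move.sign =>
        if 1 / 2 ≤ x + y then 1
        else 1 - cdf (law (1 - x - y) p : Measure ℝ) (1 / 2 - x - y)
      | Move.refrain => 1 - cdf (law (1 - x - y) p : Measure ℝ) (1 / 2 - x))

/-- The expected revenue of a pool with stake `x` that makes the choice `a`, when the other pool
has stake `y` and makes the choice `b`: the mining revenue, the signing fee for blocks of the
other pool, and the signing fee for its own blocks and for those of independent miners. -/
def revenue (law : SignatureLaw) (x y p : ℝ) (a b : Move) : ℝ :=
  miningRevenue law x y p b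
    + y * (match a with
        | Move.sign => x
        | Move.refrain => 0)
    + x * (1 - y)

/-- The revenue of pool `A`, when `A` chooses `a` and `B` chooses `b`. -/
def revenueA {n : ℕ} (law : SignatureLaw) (s : State n) (a b : Move) : ℝ :=
  revenue law (stake s.1) (stake s.2.1) (connectivity s.2.2) a b

/-- The revenue of pool `B`, when `A` chooses `a` and `B` chooses `b`. -/
def revenueB {n : ℕ} (law : SignatureLaw) (s : State n) (a b : Move) : ℝ :=
  revenue law (stake s.2.1) (stake s.1) (connectivity s.2.2) b a

/-- The attractiveness of pool `A`. -/
def attrA {n : ℕ} (law : SignatureLaw) (s : State n) (a b : Move) : ℝ :=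
  revenueA law s a b / stake s.1

/-- The attractiveness of pool `B`. -/
def attrB {n : ℕ} (law : SignatureLaw) (s : State n) (a b : Move) : ℝ :=
  revenueB law s a b / stake s.2.1

/-- The possible changes of the stake of a pool in one round. -/
inductive Change
  | lose
  | keep
  | gain
  deriving DecidableEq

instance : Fintype Change :=
  ⟨{Change.lose, Change.keep, Change.gain}, fun x => by cases x <;> decide⟩

open Classical in
/-- The probabilities of the changes of stake of a pool; `most` says that the pool is the most
attractive one (no other pool is more attractive). -/
def changeWeight (most : Prop) : Change → ℝ≥0
  | Change.lose => if most then 1 / 6 else 2 / 3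
  | Change.keep => 1 / 6
  | Change.gain => if most then 2 / 3 else 1 / 6

/-- The law of the change of stake of a pool. -/
def changeLaw (most : Prop) : PMF Change :=
  PMF.ofFintype (fun c => (changeWeight most c : ℝ≥0∞)) (by
    have huniv : (Finset.univ : Finset Change) =
        {Change.lose, Change.keep, Change.gain} := rfl
    rw [huniv, Finset.sum_insert (by decide), Finset.sum_insert (by decide),
      Finset.sum_singleton]
    norm_cast
    rw [← NNReal.coe_inj]
    simp only [changeWeight]
    split_ifs <;> push_cast <;> norm_num)

/-- The effect of a change on the index of a pool. A pool with the least stake cannot lose, and a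
pool with the greatest stake cannot gain: the stake is then retained. -/
def applyChange {n : ℕ} (i : Fin n) : Change → Fin n
  | Change.lose => ⟨(i : ℕ) - 1, lt_of_le_of_lt (Nat.sub_le _ _) i.2⟩
  | Change.keep => i
  | Change.gain => if h : (i : ℕ) + 1 < n then ⟨(i : ℕ) + 1, h⟩ else i

/-- The law of the next connectivity parameter: uniform on the current value and its
neighbours in the grid. -/
def connectivityLaw (k : Fin 101) : PMF (Fin 101) :=
  PMF.uniformOfFinset
    (Finset.univ.filter fun k' : Fin 101 => (k' : ℕ) ≤ (k : ℕ) + 1 ∧ (k : ℕ) ≤ (k' : ℕ) + 1)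
    ⟨k, by simp⟩

/-- The transitions: the stakes of the two pools change independently according to the
attractiveness of the pools, and the connectivity parameter changes independently of them. -/
def transition {n : ℕ} (law : SignatureLaw) (s : State n) (a b : Move) : PMF (State n) :=
  (changeLaw (attrB law s a b ≤ attrA law s a b)).bind fun c =>
    (changeLaw (attrA law s a b ≤ attrB law s a b)).bind fun d =>
      (connectivityLaw s.2.2).map fun k => (applyChange s.1 c, applyChange s.2.1 d, k)

/-- The game structure of the proof-of-stake pool attack; Player 1 is pool `A`, Player 2 is pool
`B`, and both choices are available to both pools in every state. -/
def game (n : ℕ) (law : SignatureLaw) : GameStructure (State n) Move where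
  moves₁ _ := Finset.univ
  moves₂ _ := Finset.univ
  moves₁_nonempty _ := ⟨Move.sign, Finset.mem_univ _⟩
  moves₂_nonempty _ := ⟨Move.sign, Finset.mem_univ _⟩
  trans s a b := transition law s a b

end ProofOfStake

end

/-! Whatever the pools do, each of the three changes of a stake has probability at least 1/6 and
each admissible connectivity value probability at least 1/3; the revenues only decide between two
change laws that share this bound. Hence from every state the play moves closer to any prescribed
target with probability at least 1/108 = (1/6)(1/6)(1/3) (`uniformlyReachable_game`), and everything
else rests on this bound.

Ergodicity: a strong law of large numbers for bounded martingale differences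
(`ae_tendsto_sum_deviation_div`) shows, level by level, that the states within distance m of the
target are visited with positive lower density, down to m = 0 (`isErgodic_of_uniformlyReachable`).

Value: the discounted game has a value vector u by Shapley's contraction. Uniform reachability
bounds the oscillation of u independently of the discount factor c, so the normalised pairs ((1 - c)
u t, u - u t) have a limit point as c tends to 1. It solves the average reward optimality equation
(`exists_isAverageSolution`), and optimal mixed actions of the one-round matrix games are stationary
strategies. The strong law turns the optimality inequalities into almost sure bounds on the mean
payoff against arbitrary history-dependent opponents (`ae_le_limInfAvg`).

Symmetry: exchanging the two pools maps the arena to itself and turns the revenue of A into that of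
B. A solution for A, negated and reflected, is therefore a solution for the reward -R_B with value
-v, and B guarantees v by playing A's optimal strategy in the mirrored state. -/

noncomputable section

/-! ### Expectations over finite probability spaces. -/

namespace PMF

variable {α β : Type*} [Fintype α] [Fintype β]

/-- The expectation of a real function under a probability mass function on a finite type. -/
def expect (p : PMF α) (f : α → ℝ) : ℝ := ∑ a, (p a).toReal * f a

lemma integral_toMeasure_eq_expect [MeasurableSpace α] [MeasurableSingletonClass α] (p : PMF α)
    (f : α → ℝ) : ∫ a, f a ∂p.toMeasure = p.expect f := by
  simp [PMF.integral_eq_sum, expect]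

lemma sum_toReal (p : PMF α) : ∑ a, (p a).toReal = 1 := by
  rw [← ENNReal.toReal_sum fun a _ => p.apply_ne_top a, ← tsum_fintype (L := .unconditional α),
    p.tsum_coe, ENNReal.toReal_one]

lemma expect_const (p : PMF α) (c : ℝ) : p.expect (fun _ => c) = c := by
  rw [expect, ← Finset.sum_mul, p.sum_toReal, one_mul]

lemma expect_mono (p : PMF α) {f g : α → ℝ} (h : ∀ a, f a ≤ g a) : p.expect f ≤ p.expect g :=
  Finset.sum_le_sum fun a _ => mul_le_mul_of_nonneg_left (h a) ENNReal.toReal_nonneg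

lemma expect_add (p : PMF α) (f g : α → ℝ) :
    p.expect (fun a => f a + g a) = p.expect f + p.expect g := by
  simp only [expect, mul_add, Finset.sum_add_distrib]

lemma expect_neg (p : PMF α) (f : α → ℝ) : p.expect (fun a => -f a) = -p.expect f := by
  simp only [expect, mul_neg, Finset.sum_neg_distrib]

lemma expect_sub (p : PMF α) (f g : α → ℝ) :
    p.expect (fun a => f a - g a) = p.expect f - p.expect g := by
  simp only [expect, mul_sub, Finset.sum_sub_distrib]

lemma expect_sub_const (p : PMF α) (f : α → ℝ) (c : ℝ) :
    p.expect (fun a => f a - c) = p.expect f - c := by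
  rw [expect_sub, expect_const]

lemma le_expect (p : PMF α) {f : α → ℝ} {c : ℝ} (h : ∀ a, c ≤ f a) : c ≤ p.expect f :=
  (p.expect_const c).symm.trans_le (p.expect_mono h)

lemma expect_le (p : PMF α) {f : α → ℝ} {c : ℝ} (h : ∀ a, f a ≤ c) : p.expect f ≤ c :=
  (p.expect_mono h).trans_eq (p.expect_const c)

/-- A point of mass at least `δ` at which `f` is below its bound `W` lowers the expectation. -/
lemma expect_le_of_le_apply (p : PMF α) {f : α → ℝ} {W δ : ℝ} (hW : ∀ a, f a ≤ W) (a : α)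
    (ha : δ ≤ (p a).toReal) : p.expect f ≤ W - δ * (W - f a) := by
  have h : δ * (W - f a) ≤ p.expect (fun b => W - f b) := by
    refine (mul_le_mul_of_nonneg_right ha (sub_nonneg.2 (hW a))).trans ?_
    exact Finset.single_le_sum (f := fun b => (p b).toReal * (W - f b))
      (fun b _ => mul_nonneg ENNReal.toReal_nonneg (sub_nonneg.2 (hW b))) (Finset.mem_univ a)
  rw [expect_sub, expect_const] at h
  linarith

lemma expect_bind (p : PMF α) (q : α → PMF β) (f : β → ℝ) :
    (p.bind q).expect f = p.expect fun a => (q a).expect f := by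
  simp only [expect, PMF.bind_apply, tsum_fintype]
  simp_rw [ENNReal.toReal_sum fun a _ => ENNReal.mul_ne_top (p.apply_ne_top _)
    ((q a).apply_ne_top _), ENNReal.toReal_mul, Finset.sum_mul, Finset.mul_sum]
  rw [Finset.sum_comm]
  simp only [mul_assoc]

lemma expect_pure (a : α) (f : α → ℝ) : (PMF.pure a).expect f = f a := by
  classical
  simp [expect, PMF.pure_apply, apply_ite ENNReal.toReal, ite_mul]

lemma expect_map (p : PMF α) (g : α → β) (f : β → ℝ) :
    (p.map g).expect f = p.expect fun a => f (g a) := by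
  rw [← PMF.bind_pure_comp, expect_bind]
  simp only [Function.comp_apply, expect_pure]

lemma expect_comm (p : PMF α) (q : PMF β) (f : α → β → ℝ) :
    p.expect (fun a => q.expect (f a)) = q.expect fun b => p.expect fun a => f a b := by
  simp only [expect, Finset.mul_sum]
  rw [Finset.sum_comm]
  simp only [mul_left_comm]

/-- The probability mass function with prescribed real weights. -/
def ofStdSimplex (x : α → ℝ) (hx : x ∈ stdSimplex ℝ α) : PMF α :=
  PMF.ofFintype (fun a => ENNReal.ofReal (x a)) (by
    rw [← ENNReal.ofReal_sum_of_nonneg fun a _ => hx.1 a, hx.2, ENNReal.ofReal_one])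

lemma expect_ofStdSimplex (x : α → ℝ) (hx : x ∈ stdSimplex ℝ α) (f : α → ℝ) :
    (ofStdSimplex x hx).expect f = ∑ a, x a * f a := by
  simp [expect, ofStdSimplex, ENNReal.toReal_ofReal (hx.1 _)]

end PMF

/-! ### Matrix games: minimax theorem and regularity of the value. -/

namespace MatrixGame

variable {α β : Type*} [Fintype α] [Fintype β]

/-- Von Neumann's minimax theorem: `v` is the value of the matrix game `M`, in which the row
player maximizes, and `p`, `q` are optimal mixed actions. -/
theorem exists_optimal [Nonempty α] [Nonempty β] (M : α → β → ℝ) :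
    ∃ (v : ℝ) (p : PMF α) (q : PMF β),
      (∀ b, v ≤ p.expect fun a => M a b) ∧ ∀ a, q.expect (fun b => M a b) ≤ v := by
  classical
  let φ : (β → ℝ) → (α → ℝ) → ℝ := fun y x => ∑ a, x a * ∑ b, y b * M a b
  have h₁ (x : α → ℝ) : IsLinearMap ℝ fun y => φ y x := by
    constructor
    · intro y z
      simp only [φ, Pi.add_apply, add_mul, Finset.sum_add_distrib, mul_add]
    · intro c y
      simp only [φ, Pi.smul_apply, smul_eq_mul, mul_assoc, Finset.mul_sum]
      simp only [mul_left_comm c]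
  have h₂ (y : β → ℝ) : IsLinearMap ℝ fun x => φ y x := by
    constructor
    · intro x z
      simp only [φ, Pi.add_apply, add_mul, Finset.sum_add_distrib]
    · intro c x
      simp only [φ, Pi.smul_apply, smul_eq_mul, mul_assoc, Finset.mul_sum]
  obtain ⟨a₀⟩ := ‹Nonempty α›
  obtain ⟨b₀⟩ := ‹Nonempty β›
  -- Sion's theorem minimises over its first variable, hence the column player's `y` comes first.
  -- Testing the saddle point against vertices of the simplices gives the bounds against pure
  -- actions.
  obtain ⟨y, hy, x, hx, hxy⟩ := Sion.exists_isSaddlePointOn (X := stdSimplex ℝ β)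
    (Y := stdSimplex ℝ α) (f := φ) ⟨_, single_mem_stdSimplex ℝ b₀⟩ (convex_stdSimplex ℝ β)
    (isCompact_stdSimplex ℝ β)
    (fun x _ => Continuous.lowerSemicontinuous (by fun_prop) |>.lowerSemicontinuousOn _)
    (fun x _ => ((h₁ x).mk' _).convexOn (convex_stdSimplex ℝ β) |>.quasiconvexOn)
    (convex_stdSimplex ℝ α) ⟨_, single_mem_stdSimplex ℝ a₀⟩ (isCompact_stdSimplex ℝ α)
    (fun y _ => Continuous.upperSemicontinuous (by fun_prop) |>.upperSemicontinuousOn _)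
    (fun y _ => ((h₂ y).mk' _).concaveOn (convex_stdSimplex ℝ α) |>.quasiconcaveOn)
  refine ⟨φ y x, PMF.ofStdSimplex x hx, PMF.ofStdSimplex y hy, fun b => ?_, fun a => ?_⟩
  · rw [PMF.expect_ofStdSimplex]
    refine (hxy _ (single_mem_stdSimplex ℝ b) _ hx).trans_eq ?_
    simp [φ, Pi.single_apply]
  · rw [PMF.expect_ofStdSimplex]
    refine (Eq.trans_le ?_ (hxy _ hy _ (single_mem_stdSimplex ℝ a)))
    simp [φ, Pi.single_apply]

variable [Nonempty α] [Nonempty β]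

/-- The value of a matrix game. -/
def value (M : α → β → ℝ) : ℝ := (exists_optimal M).choose

lemma value_spec (M : α → β → ℝ) : ∃ (p : PMF α) (q : PMF β),
    (∀ b, value M ≤ p.expect fun a => M a b) ∧ ∀ a, q.expect (fun b => M a b) ≤ value M :=
  (exists_optimal M).choose_spec

/-- Play an optimal row strategy of `M` against an optimal column strategy of `N`. Monotonicity, the
Lipschitz bound and translation equivariance of the value all come from this comparison. -/
lemma value_le_value_add {M N : α → β → ℝ} {c : ℝ} (h : ∀ a b, M a b ≤ N a b + c) :
    value M ≤ value N + c := by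
  obtain ⟨p, -, hp, -⟩ := value_spec M
  obtain ⟨-, q, -, hq⟩ := value_spec N
  calc value M ≤ q.expect fun b => p.expect fun a => M a b := q.le_expect hp
    _ = p.expect fun a => q.expect fun b => M a b := (p.expect_comm q M).symm
    _ ≤ p.expect fun a => value N + c := p.expect_mono fun a => by
        refine (q.expect_mono fun b => h a b).trans ?_
        rw [q.expect_add, q.expect_const]
        linarith [hq a]
    _ = value N + c := p.expect_const _

lemma abs_value_sub_value_le {M N : α → β → ℝ} {c : ℝ} (h : ∀ a b, |M a b - N a b| ≤ c) :
    |value M - value N| ≤ c := by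
  have h₁ : value M ≤ value N + c :=
    value_le_value_add fun a b => by linarith [(abs_sub_le_iff.1 (h a b)).1]
  have h₂ : value N ≤ value M + c :=
    value_le_value_add fun a b => by linarith [(abs_sub_le_iff.1 (h a b)).2]
  exact abs_sub_le_iff.2 ⟨by linarith, by linarith⟩

lemma continuous_value : Continuous (value : (α → β → ℝ) → ℝ) := by
  refine (LipschitzWith.of_dist_le_mul (K := 1) fun M N => ?_).continuous
  rw [NNReal.coe_one, one_mul, Real.dist_eq]
  refine abs_value_sub_value_le fun a b => ?_
  rw [← Real.dist_eq]
  exact (dist_le_pi_dist (M a) (N a) b).trans (dist_le_pi_dist M N a)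

lemma value_add_const (M : α → β → ℝ) (c : ℝ) :
    value (fun a b => M a b + c) = value M + c := by
  refine le_antisymm (value_le_value_add fun a b => le_rfl) ?_
  have : value M ≤ value (fun a b => M a b + c) + -c :=
    value_le_value_add fun a b => by linarith
  linarith

lemma le_value {M : α → β → ℝ} {c : ℝ} (h : ∀ a b, c ≤ M a b) : c ≤ value M := by
  obtain ⟨p, q, -, hq⟩ := value_spec M
  exact (p.le_expect fun a => q.le_expect fun b => h a b).trans (p.expect_le hq)

lemma value_le {M : α → β → ℝ} {c : ℝ} (h : ∀ a b, M a b ≤ c) : value M ≤ c := by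
  obtain ⟨p, q, hp, -⟩ := value_spec M
  exact (q.le_expect hp).trans (q.expect_le fun b => p.expect_le fun a => h a b)

end MatrixGame

end

noncomputable section

/-! ### Stochastic games: discounted values and the vanishing discount limit. -/

namespace StochasticGame

open MatrixGame

variable {S α β : Type*} [Fintype S]

/-- Whatever the players do, every state can be approached in every round with probability at
least `δ`: the distance `d` to the state `t` decreases, or remains zero. -/
def UniformlyReachable (P : S → α → β → PMF S) (δ : ℝ) : Prop :=
  ∀ t, ∃ d : S → ℕ, (∀ s, d s = 0 → s = t) ∧
    ∀ s a b, ∃ s', d s' ≤ d s - 1 ∧ δ ≤ (P s a b s').toReal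

variable [Fintype α] [Fintype β] [Nonempty α] [Nonempty β]

/-- The discounted Shapley equation has a solution. -/
theorem exists_discounted_value (P : S → α → β → PMF S) (r : S → α → β → ℝ) {c : ℝ} (hc₀ : 0 ≤ c)
    (hc₁ : c < 1) :
    ∃ u : S → ℝ, ∀ s, u s = value fun a b => r s a b + c * (P s a b).expect u := by
  let Φ : (S → ℝ) → S → ℝ := fun u s => value fun a b => r s a b + c * (P s a b).expect u
  -- The value and the expectation are both nonexpansive for the sup norm, so the factor `c` makes
  -- the Shapley operator a contraction.
  have hΦ : ContractingWith ⟨c, hc₀⟩ Φ := by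
    refine ⟨by exact_mod_cast hc₁, LipschitzWith.of_dist_le_mul fun u w => ?_⟩
    refine (dist_pi_le_iff (by positivity)).2 fun s => ?_
    rw [Real.dist_eq]
    refine abs_value_sub_value_le fun a b => ?_
    have hd : ∀ s, |u s - w s| ≤ dist u w := fun s => by
      rw [← Real.dist_eq]; exact dist_le_pi_dist u w s
    rw [add_sub_add_left_eq_sub, ← mul_sub, ← PMF.expect_sub, abs_mul, abs_of_nonneg hc₀]
    refine mul_le_mul_of_nonneg_left (abs_le.2 ⟨?_, ?_⟩) hc₀
    · exact PMF.le_expect _ fun s => (abs_le.1 (hd s)).1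
    · exact PMF.expect_le _ fun s => (abs_le.1 (hd s)).2
  exact ⟨hΦ.fixedPoint, fun s => (congrFun hΦ.fixedPoint_isFixedPt s).symm⟩

/-- Solutions of the discounted Shapley equation, multiplied by `1 - c`, are bounded by the
rewards. -/
lemma abs_one_sub_mul_discounted_le [Nonempty S] {P : S → α → β → PMF S} {r : S → α → β → ℝ}
    {c R : ℝ} (hc₀ : 0 ≤ c) (hc₁ : c < 1) (hr : ∀ s a b, |r s a b| ≤ R) {u : S → ℝ}
    (hu : ∀ s, u s = value fun a b => r s a b + c * (P s a b).expect u) (s : S) :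
    (1 - c) * |u s| ≤ R := by
  obtain ⟨m, hm⟩ := Finite.exists_max fun s => |u s|
  have hE : ∀ s a b, |(P s a b).expect u| ≤ |u m| := fun s a b => abs_le.2
    ⟨PMF.le_expect _ fun s => (abs_le.1 (hm s)).1, PMF.expect_le _ fun s => (abs_le.1 (hm s)).2⟩
  have hM : ∀ a b, |r m a b + c * (P m a b).expect u| ≤ R + c * |u m| := fun a b => by
    refine (abs_add_le _ _).trans (add_le_add (hr m a b) ?_)
    rw [abs_mul, abs_of_nonneg hc₀]
    exact mul_le_mul_of_nonneg_left (hE m a b) hc₀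
  have : |u m| ≤ R + c * |u m| := by
    refine abs_le.2 ⟨?_, ?_⟩
    · exact le_of_le_of_eq (le_value fun a b => (abs_le.1 (hM a b)).1) (hu m).symm
    · exact (hu m).trans_le (value_le fun a b => (abs_le.1 (hM a b)).2)
  calc (1 - c) * |u s| ≤ (1 - c) * |u m| :=
        mul_le_mul_of_nonneg_left (hm s) (sub_nonneg.2 hc₁.le)
    _ ≤ R := by linarith

/-- The oscillation of discounted values is bounded uniformly in the discount factor. -/
theorem exists_discounted_oscillation_bound [Nonempty S] {P : S → α → β → PMF S} {δ : ℝ}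
    (hδ : 0 < δ) (hP : UniformlyReachable P δ) {r : S → α → β → ℝ} {R : ℝ}
    (hr : ∀ s a b, |r s a b| ≤ R) :
    ∃ C : ℝ, ∀ c u, 0 ≤ c → c < 1 →
      (∀ s, u s = value fun a b => r s a b + c * (P s a b).expect u) →
      ∀ s t, |u s - u t| ≤ C := by
  choose d hd₀ hd using hP
  obtain ⟨N, hN⟩ : ∃ N, ∀ t s, d t s ≤ N :=
    ⟨∑ t, ∑ s, d t s, fun t s =>
      (Finset.single_le_sum (f := d t) (fun _ _ => Nat.zero_le _) (Finset.mem_univ s)).trans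
        (Finset.single_le_sum (f := fun t => ∑ s, d t s) (fun _ _ => Nat.zero_le _)
          (Finset.mem_univ t))⟩
  obtain ⟨a₀⟩ := ‹Nonempty α›
  obtain ⟨b₀⟩ := ‹Nonempty β›
  obtain ⟨s₀⟩ := ‹Nonempty S›
  have hR : 0 ≤ R := (abs_nonneg _).trans (hr s₀ a₀ b₀)
  have hδ₁ : δ ≤ 1 := by
    obtain ⟨s', -, h⟩ := hd s₀ s₀ a₀ b₀
    exact h.trans (ENNReal.toReal_le_of_le_ofReal zero_le_one
      (by simpa using (P s₀ a₀ b₀).coe_le_one s'))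
  refine ⟨2 * R * N / δ ^ N, fun c u hc₀ hc₁ hu s t => ?_⟩
  have : Nonempty S := ⟨s⟩
  have : Nonempty α := ⟨a₀⟩
  have : Nonempty β := ⟨b₀⟩
  obtain ⟨M, hM⟩ := Finite.exists_max u
  obtain ⟨m, hm⟩ := Finite.exists_min u
  -- If a state lying `D` below the maximum is reached with probability `δ`, then `u s` is itself
  -- about `δ * D` below it. One `R` pays for the reward, the other for replacing the factor `c` by
  -- 1.
  have hstep : ∀ D s, (∀ a b, ∃ s', D ≤ u M - u s' ∧ δ ≤ (P s a b s').toReal) →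
      δ * D - 2 * R ≤ u M - u s := by
    intro D s h
    suffices u s ≤ 2 * R + u M - δ * D by linarith
    rw [hu s]
    refine value_le fun a b => ?_
    obtain ⟨s', hs', hPs⟩ := h a b
    have h₁ := (P s a b).expect_le_of_le_apply hM s' hPs
    have h₂ : u m ≤ (P s a b).expect u := PMF.le_expect _ hm
    have h₃ := abs_one_sub_mul_discounted_le hc₀ hc₁ hr hu m
    have h₄ : -R ≤ (1 - c) * (P s a b).expect u := by
      have := mul_le_mul_of_nonneg_left (h₂.trans' (neg_abs_le (u m))) (sub_nonneg.2 hc₁.le)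
      linarith
    have h₅ := mul_le_mul_of_nonneg_left hs' hδ.le
    linarith [(abs_le.1 (hr s a b)).2]
  -- The deficit propagates from the minimiser `m` along the distance to it. At `s = M` the right
  -- side is zero, which bounds the oscillation.
  have hind : ∀ k s, d m s ≤ k → δ ^ k * (u M - u m) - 2 * R * k ≤ u M - u s := by
    intro k
    induction k with
    | zero => intro s hs; rw [hd₀ m s (Nat.le_zero.1 hs)]; simp
    | succ k ih =>
      intro s hs
      refine le_trans ?_ (hstep (δ ^ k * (u M - u m) - 2 * R * k) s fun a b => ?_)
      · have : δ * (2 * R * k) ≤ 2 * R * k := mul_le_of_le_one_left (by positivity) hδ₁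
        push_cast
        rw [pow_succ]
        linarith
      · obtain ⟨s', h, h'⟩ := hd m s a b
        exact ⟨s', ih s' (by omega), h'⟩
  have hW : u M - u m ≤ 2 * R * N / δ ^ N := by
    rw [le_div_iff₀ (by positivity)]
    linarith [hind N M (hN m M)]
  exact abs_le.2 ⟨by linarith [hM s, hm s, hM t, hm t], by linarith [hM s, hm s, hM t, hm t]⟩

/-- The average reward optimality equation: `v` is the mean payoff, `h` the relative value and `x`,
`y` are optimal stationary strategies of the two players. -/
structure IsAverageSolution (P : S → α → β → PMF S) (r : S → α → β → ℝ) (v : ℝ) (h : S → ℝ)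
    (x : S → PMF α) (y : S → PMF β) : Prop where
  le_left : ∀ s b, v + h s ≤ (x s).expect fun a => r s a b + (P s a b).expect h
  right_le : ∀ s a, ((y s).expect fun b => r s a b + (P s a b).expect h) ≤ v + h s

/-- The average reward optimality equation of a uniformly reachable game has a solution. -/
theorem exists_isAverageSolution [Nonempty S] {P : S → α → β → PMF S} {δ : ℝ}
    (hδ : 0 < δ) (hP : UniformlyReachable P δ) (r : S → α → β → ℝ) :
    ∃ v h x y, IsAverageSolution P r v h x y := by
  obtain ⟨R, hr⟩ : ∃ R, ∀ s a b, |r s a b| ≤ R := by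
    refine ⟨‖r‖, fun s a b => ?_⟩
    exact (norm_le_pi_norm (r s a) b).trans
      ((norm_le_pi_norm (r s) a).trans (norm_le_pi_norm r s))
  obtain ⟨C, hC⟩ := exists_discounted_oscillation_bound hδ hP hr
  obtain ⟨t⟩ := ‹Nonempty S›
  have : Nonempty S := ⟨t⟩
  have hc₀ (n : ℕ) : (0 : ℝ) ≤ n / (n + 1) := by positivity
  have hc₁ (n : ℕ) : (n : ℝ) / (n + 1) < 1 := (div_lt_one (by positivity)).2 (by linarith)
  choose u hu using fun n : ℕ => exists_discounted_value P r (hc₀ n) (hc₁ n)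
  -- The discounted values themselves may diverge as the discount factor n/(n+1) tends to 1; the
  -- scaled value at `t` and the differences stay bounded.
  let z : ℕ → ℝ × (S → ℝ) := fun n => ((1 - (n : ℝ) / (n + 1)) * u n t, fun s => u n s - u n t)
  have hz : ∀ n, z n ∈ Metric.closedBall (0 : ℝ × (S → ℝ)) (max R C) := by
    intro n
    rw [mem_closedBall_zero_iff, Prod.norm_def]
    refine max_le_max ?_ ?_
    · rw [Real.norm_eq_abs, abs_mul, abs_of_nonneg (sub_nonneg.2 (hc₁ n).le)]
      exact abs_one_sub_mul_discounted_le (hc₀ n) (hc₁ n) hr (hu n) t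
    · have h := hC _ _ (hc₀ n) (hc₁ n) (hu n)
      exact (pi_norm_le_iff_of_nonneg ((abs_nonneg _).trans (h t t))).2 fun s => h s t
  obtain ⟨⟨v, h⟩, -, φ, hφ, hlim⟩ := tendsto_subseq_of_bounded Metric.isBounded_closedBall hz
  have hlim₁ : Tendsto (fun n => (z (φ n)).1) atTop (nhds v) := (continuous_fst.tendsto _).comp hlim
  have hlim₂ : Tendsto (fun n => (z (φ n)).2) atTop (nhds h) := (continuous_snd.tendsto _).comp hlim
  -- The Shapley equation with the constant `c * u t` moved out of the value, a form that survives
  -- the limit.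
  have heq : ∀ n s, (z n).1 + (z n).2 s =
      value fun a b => r s a b + (n : ℝ) / (n + 1) * (P s a b).expect (z n).2 := by
    intro n s
    have h₁ : (fun a b => r s a b + (n : ℝ) / (n + 1) * (P s a b).expect (u n)) = fun a b =>
        (r s a b + (n : ℝ) / (n + 1) * (P s a b).expect (z n).2) + (n : ℝ) / (n + 1) * u n t := by
      funext a b
      simp only [z, PMF.expect_sub_const]
      ring
    have h₂ := hu n s
    rw [h₁, value_add_const] at h₂
    simp only [z] at h₂ ⊢
    linarith
  have hval : ∀ s, v + h s = value fun a b => r s a b + (P s a b).expect h := by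
    intro s
    have hcont : Continuous fun w : ℝ × (S → ℝ) =>
        value fun a b => r s a b + w.1 * (P s a b).expect w.2 := by
      refine continuous_value.comp ?_
      unfold PMF.expect
      fun_prop
    have hφc : Tendsto (fun n => ((φ n : ℝ) / (φ n + 1), (z (φ n)).2)) atTop (nhds (1, h)) :=
      ((tendsto_natCast_div_add_atTop (1 : ℝ)).comp hφ.tendsto_atTop).prodMk_nhds hlim₂
    have h₁ := (hcont.tendsto (1, h)).comp hφc
    have h₂ := hlim₁.add (((continuous_apply s).tendsto h).comp hlim₂)
    simp only [one_mul] at h₁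
    exact tendsto_nhds_unique (h₂.congr fun n => heq (φ n) s) h₁
  choose x y hx hy using fun s => value_spec fun a b => r s a b + (P s a b).expect h
  exact ⟨v, h, x, y, fun s b => (hval s).trans_le (hx s b),
    fun s a => (hy s a).trans_eq (hval s).symm⟩

end StochasticGame

end

/-! ### A strong law of large numbers for trajectories of Markov kernels. -/

noncomputable section

/-- If the averages of a real sequence with bounded increments tend to zero along the squares, then
they tend to zero. -/
lemma tendsto_div_of_tendsto_div_sq {u : ℕ → ℝ} {C : ℝ} (hC : ∀ n, |u (n + 1) - u n| ≤ C)
    (h : Tendsto (fun m : ℕ => u (m ^ 2) / (m : ℝ) ^ 2) atTop (nhds 0)) :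
    Tendsto (fun n : ℕ => u n / n) atTop (nhds 0) := by
  have hC₀ : 0 ≤ C := (abs_nonneg _).trans (hC 0)
  have hinc : ∀ n k, |u (n + k) - u n| ≤ k * C := by
    intro n k
    induction k with
    | zero => simp
    | succ k ih =>
      have := abs_add_le (u (n + k + 1) - u (n + k)) (u (n + k) - u n)
      rw [sub_add_sub_cancel] at this
      push_cast
      rw [← add_assoc]
      linarith [hC (n + k)]
  have hsqrt : Tendsto Nat.sqrt atTop atTop :=
    tendsto_atTop.2 fun b => (eventually_ge_atTop (b * b)).mono fun n hn => Nat.le_sqrt.2 hn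
  have hbound : Tendsto (fun m : ℕ => |u (m ^ 2) / (m : ℝ) ^ 2| + 2 * C / m) atTop (nhds 0) := by
    simpa using h.abs.add (tendsto_const_div_atTop_nhds_zero_nat (2 * C))
  refine squeeze_zero_norm' ?_ (hbound.comp hsqrt)
  filter_upwards [eventually_ge_atTop 1] with n hn
  obtain ⟨k, hk⟩ := Nat.exists_eq_add_of_le (Nat.sqrt_le' n)
  -- Consecutive squares around `n` differ by at most 2√n + 1, so the increments since the last
  -- square are negligible after division by `n`.
  have hk' : k ≤ 2 * n.sqrt := by
    have := Nat.sqrt_le_add n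
    nlinarith
  have hm : (0 : ℝ) < n.sqrt := by exact_mod_cast Nat.sqrt_pos.2 hn
  have hmn : (n.sqrt : ℝ) ^ 2 ≤ n := by exact_mod_cast Nat.sqrt_le' n
  have hn' : (0 : ℝ) < n := by exact_mod_cast hn
  have h₁ : |u n| ≤ |u (n.sqrt ^ 2)| + 2 * n.sqrt * C := by
    have h₂ := hinc (n.sqrt ^ 2) k
    rw [← hk] at h₂
    have h₃ := abs_add_le (u n - u (n.sqrt ^ 2)) (u (n.sqrt ^ 2))
    rw [sub_add_cancel] at h₃
    have h₄ : (k : ℝ) * C ≤ 2 * n.sqrt * C :=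
      mul_le_mul_of_nonneg_right (by exact_mod_cast hk') hC₀
    linarith
  simp only [Function.comp_apply, Real.norm_eq_abs]
  rw [abs_div, abs_div, abs_of_pos hn', abs_of_pos (pow_pos hm 2)]
  calc |u n| / n ≤ (|u (n.sqrt ^ 2)| + 2 * n.sqrt * C) / n := by gcongr
    _ ≤ (|u (n.sqrt ^ 2)| + 2 * n.sqrt * C) / (n.sqrt : ℝ) ^ 2 := by gcongr
    _ = _ := by field_simp

namespace ProbabilityTheory.Kernel

open Preorder

variable {X : ℕ → Type*} [∀ n, MeasurableSpace (X n)] {μ₀ : Measure (X 0)}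
  [IsProbabilityMeasure μ₀] {κ : (n : ℕ) → Kernel (Π i : Finset.Iic n, X i) (X (n + 1))}

/-- The deviation of `f (n + 1)` from its conditional mean given the coordinates up to `n`. -/
def deviation (κ : (n : ℕ) → Kernel (Π i : Finset.Iic n, X i) (X (n + 1)))
    (f : (n : ℕ) → X n → ℝ) (n : ℕ) (ω : Π n, X n) : ℝ :=
  f (n + 1) (ω (n + 1)) - ∫ x, f (n + 1) x ∂κ n (frestrictLe n ω)

variable {f : (n : ℕ) → X n → ℝ} {B : ℝ}

lemma measurable_integral_kernel (hf : ∀ n, Measurable (f n)) (n : ℕ) :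
    Measurable fun x => ∫ y, f (n + 1) y ∂κ n x :=
  (hf (n + 1)).stronglyMeasurable.integral_kernel.measurable

lemma measurable_deviation (hf : ∀ n, Measurable (f n)) (n : ℕ) :
    Measurable (deviation κ f n) :=
  ((hf (n + 1)).comp (measurable_pi_apply _)).sub
    ((measurable_integral_kernel hf n).comp (measurable_frestrictLe n))

lemma measurable_sum_deviation (hf : ∀ n, Measurable (f n)) (T : ℕ) :
    Measurable fun ω => ∑ k ∈ Finset.range T, deviation κ f k ω :=
  Finset.measurable_sum _ fun k _ => measurable_deviation hf k

/-- Adaptedness of the martingale, in the form needed to use the partial sum as the function of the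
past in `integral_mul_deviation_eq_zero`. -/
lemma exists_sum_deviation_eq_comp_frestrictLe (hf : ∀ n, Measurable (f n)) (T : ℕ) :
    ∃ g : (Π i : Finset.Iic T, X i) → ℝ, Measurable g ∧
      ∀ ω, ∑ k ∈ Finset.range T, deviation κ f k ω = g (frestrictLe T ω) := by
  induction T with
  | zero => exact ⟨fun _ => 0, measurable_const, fun ω => by simp⟩
  | succ T ih =>
    obtain ⟨g, hg, hgT⟩ := ih
    refine ⟨fun x => g (frestrictLe₂ T.le_succ x) + (f (T + 1) (x ⟨T + 1, by simp⟩) -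
      ∫ y, f (T + 1) y ∂κ T (frestrictLe₂ T.le_succ x)), ?_, fun ω => ?_⟩
    · have h₁ := (hf (T + 1)).comp (measurable_pi_apply
        (X := fun i : Finset.Iic (T + 1) => X i) ⟨T + 1, by simp⟩)
      have h₂ := (measurable_integral_kernel (κ := κ) hf T).comp
        (measurable_frestrictLe₂ (X := X) T.le_succ)
      exact (hg.comp (measurable_frestrictLe₂ T.le_succ)).add (h₁.sub h₂)
    · rw [Finset.sum_range_succ, hgT]
      rfl

variable [∀ n, IsMarkovKernel (κ n)]

lemma abs_integral_le_of_bound (hB : ∀ n x, |f n x| ≤ B) (n : ℕ) (x : Π i : Finset.Iic n, X i) :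
    |∫ y, f (n + 1) y ∂κ n x| ≤ B := by
  simpa using norm_integral_le_of_norm_le_const (μ := κ n x) (f := f (n + 1)) (C := B)
    (Eventually.of_forall fun y => hB (n + 1) y)

lemma abs_deviation_le (hB : ∀ n x, |f n x| ≤ B) (n : ℕ) (ω : Π n, X n) :
    |deviation κ f n ω| ≤ 2 * B := by
  have h₁ := hB (n + 1) (ω (n + 1))
  have h₂ := abs_integral_le_of_bound (κ := κ) hB n (frestrictLe n ω)
  have h₃ := abs_sub (f (n + 1) (ω (n + 1))) (∫ x, f (n + 1) x ∂κ n (frestrictLe n ω))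
  unfold deviation
  linarith

lemma abs_sum_deviation_le (hB : ∀ n x, |f n x| ≤ B) (T : ℕ) (ω : Π n, X n) :
    |∑ k ∈ Finset.range T, deviation κ f k ω| ≤ T * (2 * B) := by
  refine (Finset.abs_sum_le_sum_abs _ _).trans ?_
  refine (Finset.sum_le_card_nsmul _ _ _ fun k _ => abs_deviation_le hB k ω).trans_eq ?_
  simp

/-- Deviations are orthogonal to the functions of the past. -/
lemma integral_mul_deviation_eq_zero (hf : ∀ n, Measurable (f n)) (hB : ∀ n x, |f n x| ≤ B) (n : ℕ)
    {g : (Π i : Finset.Iic n, X i) → ℝ} (hg : Measurable g) {K : ℝ}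
    (hK : ∀ ω : Π n, X n, |g (frestrictLe n ω)| ≤ K) :
    ∫ ω, g (frestrictLe n ω) * deviation κ f n ω ∂trajMeasure μ₀ κ = 0 := by
  let ψ : (Π i : Finset.Iic n, X i) × X (n + 1) → ℝ := fun p =>
    g p.1 * (f (n + 1) p.2 - ∫ x, f (n + 1) x ∂κ n p.1)
  have hψ : Measurable ψ := (hg.comp measurable_fst).mul
    (((hf (n + 1)).comp measurable_snd).sub ((measurable_integral_kernel hf n).comp measurable_fst))
  have hpair : Measurable fun ω : Π n, X n => (frestrictLe n ω, ω (n + 1)) :=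
    (measurable_frestrictLe n).prodMk (measurable_pi_apply _)
  -- The joint law of the past and the next coordinate is a composition product; integrating the
  -- next coordinate first makes the centred factor vanish.
  have hmap : ∫ ω, g (frestrictLe n ω) * deviation κ f n ω ∂trajMeasure μ₀ κ =
      ∫ p, ψ p ∂((trajMeasure μ₀ κ).map (frestrictLe n) ⊗ₘ κ n) := by
    rw [map_frestrictLe_trajMeasure_compProd_eq_map_trajMeasure,
      integral_map hpair.aemeasurable hψ.aestronglyMeasurable]
    rfl
  have hint : Integrable ψ ((trajMeasure μ₀ κ).map (frestrictLe n) ⊗ₘ κ n) := by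
    rw [map_frestrictLe_trajMeasure_compProd_eq_map_trajMeasure,
      integrable_map_measure hψ.aestronglyMeasurable hpair.aemeasurable]
    refine Integrable.of_bound (hψ.comp hpair).aestronglyMeasurable (K * (2 * B))
      (Eventually.of_forall fun ω => ?_)
    rw [Real.norm_eq_abs, Function.comp_apply, abs_mul]
    exact mul_le_mul (hK ω) (abs_deviation_le (κ := κ) hB n ω) (abs_nonneg _)
      ((abs_nonneg _).trans (hK ω))
  rw [hmap, Measure.integral_compProd hint]
  refine integral_eq_zero_of_ae (Eventually.of_forall fun x => ?_)
  have hfint : Integrable (f (n + 1)) (κ n x) :=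
    Integrable.of_bound (hf _).aestronglyMeasurable B (Eventually.of_forall fun y => hB (n + 1) y)
  simp only [ψ, Pi.zero_apply]
  rw [integral_const_mul, integral_sub hfint (integrable_const _), MeasureTheory.integral_const]
  simp

/-- Orthogonality kills the cross terms, so second moments add up and grow only linearly. -/
lemma integral_sq_sum_deviation_le (hf : ∀ n, Measurable (f n)) (hB : ∀ n x, |f n x| ≤ B)
    (T : ℕ) :
    ∫ ω, (∑ k ∈ Finset.range T, deviation κ f k ω) ^ 2 ∂trajMeasure μ₀ κ ≤ T * (2 * B) ^ 2 := by
  induction T with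
  | zero => simp
  | succ T ih =>
    obtain ⟨g, hg, hgT⟩ := exists_sum_deviation_eq_comp_frestrictLe (κ := κ) hf T
    have hbound {F : (Π n, X n) → ℝ} (hF : Measurable F) (K : ℝ) (hFK : ∀ ω, |F ω| ≤ K) :
        Integrable F (trajMeasure μ₀ κ) :=
      Integrable.of_bound hF.aestronglyMeasurable K (Eventually.of_forall hFK)
    have hM := measurable_sum_deviation (κ := κ) hf T
    have hD := measurable_deviation (κ := κ) hf T
    have hMb := abs_sum_deviation_le (κ := κ) hB T
    have hDb := abs_deviation_le (κ := κ) hB T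
    have h0 := integral_mul_deviation_eq_zero (μ₀ := μ₀) (κ := κ) hf hB T hg
      (K := T * (2 * B)) fun ω => by rw [← hgT]; exact hMb ω
    simp_rw [← hgT] at h0
    simp_rw [Finset.sum_range_succ, add_sq, mul_assoc]
    have hi₁ : Integrable (fun ω => (∑ k ∈ Finset.range T, deviation κ f k ω) ^ 2)
        (trajMeasure μ₀ κ) := hbound (hM.pow_const 2) ((T * (2 * B)) ^ 2) fun ω => by
      rw [abs_pow]; exact pow_le_pow_left₀ (abs_nonneg _) (hMb ω) 2
    have hi₂ : Integrable (fun ω => 2 * ((∑ k ∈ Finset.range T, deviation κ f k ω) *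
        deviation κ f T ω)) (trajMeasure μ₀ κ) :=
      (hbound (hM.mul hD) (T * (2 * B) * (2 * B)) fun ω => by
        rw [Pi.mul_apply, abs_mul]
        exact mul_le_mul (hMb ω) (hDb ω) (abs_nonneg _) ((abs_nonneg _).trans (hMb ω))).const_mul 2
    have hsq : ∀ ω, deviation κ f T ω ^ 2 ≤ (2 * B) ^ 2 := fun ω => by
      rw [← sq_abs]; exact pow_le_pow_left₀ (abs_nonneg _) (hDb ω) 2
    have hi₃ : Integrable (fun ω => deviation κ f T ω ^ 2) (trajMeasure μ₀ κ) :=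
      hbound (hD.pow_const 2) ((2 * B) ^ 2) fun ω => by
        rw [abs_of_nonneg (sq_nonneg _)]; exact hsq ω
    have hi₁₂ : Integrable (fun ω => (∑ k ∈ Finset.range T, deviation κ f k ω) ^ 2 +
        2 * ((∑ k ∈ Finset.range T, deviation κ f k ω) * deviation κ f T ω))
        (trajMeasure μ₀ κ) := hi₁.add hi₂
    rw [integral_add hi₁₂ hi₃, integral_add hi₁ hi₂, integral_const_mul, h0]
    have h3 : ∫ ω, deviation κ f T ω ^ 2 ∂trajMeasure μ₀ κ ≤ (2 * B) ^ 2 := by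
      refine (integral_mono hi₃ (integrable_const _) hsq).trans_eq ?_
      simp
    push_cast
    linarith

/-- Strong law of large numbers: the averages of the deviations of bounded functions from their
conditional means tend to zero almost surely. -/
theorem ae_tendsto_sum_deviation_div (hf : ∀ n, Measurable (f n)) (hB : ∀ n x, |f n x| ≤ B) :
    ∀ᵐ ω ∂trajMeasure μ₀ κ,
      Tendsto (fun T : ℕ => (∑ k ∈ Finset.range T, deviation κ f k ω) / T) atTop (nhds 0) := by
  let M : ℕ → (Π n, X n) → ℝ := fun T ω => ∑ k ∈ Finset.range T, deviation κ f k ω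
  -- Along the squares the second moments of the averages are O(1/m²), hence summable: almost surely
  -- the series of squared averages converges and its terms tend to zero.
  let F : ℕ → (Π n, X n) → ℝ≥0∞ := fun m ω => ENNReal.ofReal ((M (m ^ 2) ω / (m : ℝ) ^ 2) ^ 2)
  have hF : ∀ m, Measurable (F m) := fun m =>
    (((measurable_sum_deviation hf _).div_const _).pow_const 2).ennreal_ofReal
  have hFle : ∀ m, ∫⁻ ω, F m ω ∂trajMeasure μ₀ κ ≤
      ENNReal.ofReal ((2 * B) ^ 2 * (1 / (m : ℝ) ^ 2)) := by
    intro m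
    have hint : Integrable (fun ω => (M (m ^ 2) ω / (m : ℝ) ^ 2) ^ 2) (trajMeasure μ₀ κ) := by
      refine Integrable.of_bound
        (((measurable_sum_deviation hf _).div_const _).pow_const 2).aestronglyMeasurable
        (((m ^ 2 : ℕ) * (2 * B) / (m : ℝ) ^ 2) ^ 2) (Eventually.of_forall fun ω => ?_)
      rw [Real.norm_eq_abs, abs_pow, abs_div, abs_of_nonneg (by positivity : (0 : ℝ) ≤ (m : ℝ) ^ 2)]
      have := abs_sum_deviation_le (κ := κ) hB (m ^ 2) ω
      gcongr
    rw [← ofReal_integral_eq_lintegral_ofReal hint (Eventually.of_forall fun ω => sq_nonneg _)]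
    refine ENNReal.ofReal_le_ofReal ?_
    simp_rw [div_pow]
    rw [integral_div]
    have h := integral_sq_sum_deviation_le (μ₀ := μ₀) (κ := κ) hf hB (m ^ 2)
    rcases Nat.eq_zero_or_pos m with rfl | hm
    · simp
    · have hm' : (0 : ℝ) < m := by exact_mod_cast hm
      rw [div_le_iff₀ (by positivity)]
      refine h.trans_eq ?_
      push_cast
      field_simp
  have hsum : ∫⁻ ω, ∑' m, F m ω ∂trajMeasure μ₀ κ ≠ ∞ := by
    rw [lintegral_tsum fun m => (hF m).aemeasurable]
    refine ne_top_of_le_ne_top ?_ (ENNReal.tsum_le_tsum hFle)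
    exact ((Real.summable_one_div_nat_pow.2 one_lt_two).mul_left _).tsum_ofReal_ne_top
  filter_upwards [ae_lt_top (Measurable.tsum hF) hsum] with ω hω
  refine tendsto_div_of_tendsto_div_sq (C := 2 * B) (fun n => ?_) ?_
  · rw [Finset.sum_range_succ, add_sub_cancel_left]
    exact abs_deviation_le hB n ω
  · have h := (ENNReal.tendsto_toReal ENNReal.zero_ne_top).comp
      (ENNReal.tendsto_atTop_zero_of_tsum_ne_top hω.ne)
    have h' := h.sqrt
    rw [ENNReal.toReal_zero, Real.sqrt_zero] at h'
    refine (tendsto_zero_iff_abs_tendsto_zero _).2 (h'.congr fun m => ?_)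
    simp only [F, M, Function.comp_apply, ENNReal.toReal_ofReal (sq_nonneg _), Real.sqrt_sq_eq_abs]

end ProbabilityTheory.Kernel

end

noncomputable section

/-! ### Plays of a concurrent game: rounds, average rewards, guarantees. -/

namespace ConcurrentGame

/-- The strategy that chooses its moves according to the current state only. -/
def Strategy.stationary {S Act : Type*} {moves : S → Finset Act} (x : S → PMF Act)
    (hx : ∀ s, (x s).support ⊆ (moves s : Set Act)) : Strategy moves where
  move _ _ s := x s
  legal _ _ s := hx s

namespace GameStructure

open StochasticGame

section Rounds

variable {S Act : Type*} [Fintype S] [Fintype Act]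

variable (G : GameStructure S Act) (σ₁ : G.Strategy₁) (σ₂ : G.Strategy₂)

lemma expect_turn (k : ℕ) (h : Fin k → S × Act × Act) (s : S) (f : S × Act × Act → ℝ) :
    (G.turn σ₁ σ₂ k h s).expect f =
      (σ₁.move k h s).expect fun a => (σ₂.move k h s).expect fun b => f (s, a, b) := by
  simp only [turn, PMF.expect_bind, PMF.expect_map]

lemma expect_nextRound (k : ℕ) (h : Fin (k + 1) → S × Act × Act) (f : S × Act × Act → ℝ) :
    (G.nextRound σ₁ σ₂ k h).expect f =
      (G.trans (h (Fin.last k)).1 (h (Fin.last k)).2.1 (h (Fin.last k)).2.2).expect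
        fun s => (G.turn σ₁ σ₂ (k + 1) h s).expect f := by
  simp only [nextRound, PMF.expect_bind]

/-- For a function of the state alone the mixed moves of the coming round integrate out, so its
conditional mean depends only on the last round. -/
lemma expect_nextRound_fst (k : ℕ) (h : Fin (k + 1) → S × Act × Act) (f : S → ℝ) :
    (G.nextRound σ₁ σ₂ k h).expect (fun x => f x.1) =
      (G.trans (h (Fin.last k)).1 (h (Fin.last k)).2.1 (h (Fin.last k)).2.2).expect f := by
  simp only [expect_nextRound, expect_turn, PMF.expect_const]

variable [MeasurableSpace S] [MeasurableSingletonClass S] [MeasurableSpace Act]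
  [MeasurableSingletonClass Act]

instance (s : S) : IsProbabilityMeasure (G.playMeasure σ₁ σ₂ s) := by
  unfold playMeasure
  infer_instance

/-- Strong law of large numbers for plays. -/
theorem ae_tendsto_sum_sub_expect_nextRound_div (s : S) (f : S × Act × Act → ℝ) :
    ∀ᵐ ω ∂G.playMeasure σ₁ σ₂ s, Tendsto (fun T : ℕ => (∑ k ∈ Finset.range T,
      (f (ω (k + 1)) - (G.nextRound σ₁ σ₂ k fun i => ω i).expect f)) / T) atTop (nhds 0) := by
  have h := Kernel.ae_tendsto_sum_deviation_div (X := fun _ => S × Act × Act)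
    (μ₀ := (G.turn σ₁ σ₂ 0 Fin.elim0 s).toMeasure) (κ := G.roundKernel σ₁ σ₂) (f := fun _ => f)
    (B := ‖f‖) (fun _ => measurable_of_countable f) (fun _ x => norm_le_pi_norm f x)
  filter_upwards [h] with ω hω
  refine hω.congr fun T => ?_
  congr 1
  refine Finset.sum_congr rfl fun k _ => ?_
  rw [← PMF.integral_toMeasure_eq_expect]
  rfl

end Rounds

section Averages

variable {S Act : Type*}

lemma abs_avg_le {r : S → Act → Act → ℝ} {R : ℝ} (hr : ∀ s a b, |r s a b| ≤ R) (T : ℕ)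
    (ω : ℕ → S × Act × Act) : |avg r T ω| ≤ R := by
  have hR : 0 ≤ R := (abs_nonneg _).trans (hr (ω 0).1 (ω 0).2.1 (ω 0).2.2)
  rcases Nat.eq_zero_or_pos T with rfl | hT
  · simpa [avg] using hR
  have hT' : (0 : ℝ) < T := by exact_mod_cast hT
  rw [avg, abs_mul, abs_of_nonneg (by positivity), one_div, inv_mul_le_iff₀ hT']
  refine (Finset.abs_sum_le_sum_abs _ _).trans ?_
  refine (Finset.sum_le_card_nsmul _ _ _ fun k _ => hr _ _ _).trans_eq ?_
  simp

lemma avg_neg (r : S → Act → Act → ℝ) (T : ℕ) (ω : ℕ → S × Act × Act) :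
    avg (fun s a b => -r s a b) T ω = -avg r T ω := by
  simp [avg]

variable [Fintype S] [Fintype Act] (r : S → Act → Act → ℝ)

lemma exists_abs_reward_le : ∃ R, ∀ s a b, |r s a b| ≤ R :=
  ⟨‖r‖, fun s a b => (norm_le_pi_norm (r s a) b).trans
    ((norm_le_pi_norm (r s) a).trans (norm_le_pi_norm r s))⟩

lemma isBoundedUnder_le_avg (ω : ℕ → S × Act × Act) :
    IsBoundedUnder (· ≤ ·) atTop fun T => avg r T ω := by
  obtain ⟨R, hR⟩ := exists_abs_reward_le r
  exact isBoundedUnder_of ⟨R, fun T => (abs_le.1 (abs_avg_le hR T ω)).2⟩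

lemma isBoundedUnder_ge_avg (ω : ℕ → S × Act × Act) :
    IsBoundedUnder (· ≥ ·) atTop fun T => avg r T ω := by
  obtain ⟨R, hR⟩ := exists_abs_reward_le r
  exact isBoundedUnder_of ⟨-R, fun T => (abs_le.1 (abs_avg_le hR T ω)).1⟩

lemma limInfAvg_le_limSupAvg (ω : ℕ → S × Act × Act) : limInfAvg r ω ≤ limSupAvg r ω :=
  liminf_le_limsup (isBoundedUnder_le_avg r ω) (isBoundedUnder_ge_avg r ω)

lemma limInfAvg_neg (ω : ℕ → S × Act × Act) :
    limInfAvg (fun s a b => -r s a b) ω = -limSupAvg r ω := by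
  simp only [limInfAvg, limSupAvg, avg_neg]
  exact (Antitone.map_limsup_of_continuousAt (f := fun x : ℝ => -x) (fun _ _ h => neg_le_neg h)
    (fun T => avg r T ω) continuous_neg.continuousAt (isBoundedUnder_le_avg r ω)
    (isBoundedUnder_ge_avg r ω).isCoboundedUnder_le).symm

variable {r}

lemma abs_limInfAvg_le {R : ℝ} (hr : ∀ s a b, |r s a b| ≤ R) (ω : ℕ → S × Act × Act) :
    |limInfAvg r ω| ≤ R := by
  refine abs_le.2 ⟨?_, ?_⟩
  · exact le_liminf_of_le (isBoundedUnder_le_avg r ω).isCoboundedUnder_ge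
      (Eventually.of_forall fun T => (abs_le.1 (abs_avg_le hr T ω)).1)
  · exact liminf_le_of_le (isBoundedUnder_ge_avg r ω) fun b hb =>
      hb.exists.choose_spec.trans (abs_le.1 (abs_avg_le hr _ ω)).2

variable (r)

lemma limSupAvg_eq_neg_limInfAvg (ω : ℕ → S × Act × Act) :
    limSupAvg r ω = -limInfAvg (fun s a b => -r s a b) ω := by
  rw [limInfAvg_neg, neg_neg]

variable [MeasurableSpace S] [MeasurableSingletonClass S] [MeasurableSpace Act]
  [MeasurableSingletonClass Act]

lemma measurable_limInfAvg : Measurable (limInfAvg r) := by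
  refine Measurable.liminf fun T => ?_
  refine (Finset.measurable_sum _ fun i _ => ?_).const_mul _
  exact (measurable_of_countable fun x : S × Act × Act => r x.1 x.2.1 x.2.2).comp
    (measurable_pi_apply i)

variable (G : GameStructure S Act) (σ₁ : G.Strategy₁) (σ₂ : G.Strategy₂)

lemma integrable_limInfAvg (s : S) : Integrable (limInfAvg r) (G.playMeasure σ₁ σ₂ s) := by
  obtain ⟨R, hR⟩ := exists_abs_reward_le r
  exact Integrable.of_bound (measurable_limInfAvg r).aestronglyMeasurable R
    (Eventually.of_forall fun ω => abs_limInfAvg_le hR ω)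

lemma integrable_limSupAvg (s : S) : Integrable (limSupAvg r) (G.playMeasure σ₁ σ₂ s) := by
  rw [funext (limSupAvg_eq_neg_limInfAvg r)]
  exact (integrable_limInfAvg _ G σ₁ σ₂ s).neg

/-- Reduces every bound for the minimising player to one for the maximising player. -/
lemma expLimInfAvg_neg (s : S) :
    G.expLimInfAvg (fun s a b => -r s a b) σ₁ σ₂ s = -G.expLimSupAvg r σ₁ σ₂ s := by
  simp only [expLimInfAvg, expLimSupAvg, limInfAvg_neg, integral_neg]

lemma expLimInfAvg_le_expLimSupAvg (s : S) :
    G.expLimInfAvg r σ₁ σ₂ s ≤ G.expLimSupAvg r σ₁ σ₂ s :=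
  integral_mono (integrable_limInfAvg r G σ₁ σ₂ s) (integrable_limSupAvg r G σ₁ σ₂ s)
    (limInfAvg_le_limSupAvg r)

variable {r}

lemma abs_expLimInfAvg_le {R : ℝ} (hr : ∀ s a b, |r s a b| ≤ R) (s : S) :
    |G.expLimInfAvg r σ₁ σ₂ s| ≤ R := by
  simpa [expLimInfAvg] using norm_integral_le_of_norm_le_const (μ := G.playMeasure σ₁ σ₂ s)
    (f := limInfAvg r) (C := R) (Eventually.of_forall fun ω => abs_limInfAvg_le hr ω)

lemma abs_expLimSupAvg_le {R : ℝ} (hr : ∀ s a b, |r s a b| ≤ R) (s : S) :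
    |G.expLimSupAvg r σ₁ σ₂ s| ≤ R := by
  have h := abs_expLimInfAvg_le (r := fun s a b => -r s a b) G σ₁ σ₂ (R := R)
    (fun s a b => by rw [abs_neg]; exact hr s a b) s
  rwa [expLimInfAvg_neg, abs_neg] at h

variable {G σ₁ σ₂}

/-- If the optimality inequality holds in every round, then the mean payoff is almost surely at
least `v`. -/
theorem ae_le_limInfAvg {v : ℝ} {g : S → ℝ}
    (hv : ∀ k h s, v + g s ≤ (σ₁.move k h s).expect fun a => (σ₂.move k h s).expect fun b =>
      r s a b + (G.trans s a b).expect g) (s : S) :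
    ∀ᵐ ω ∂G.playMeasure σ₁ σ₂ s, v ≤ limInfAvg r ω := by
  -- `ψ` is the surplus of a round in the optimality inequality. Given the past, its mean is
  -- nonnegative, so by the strong law its averages cannot have a negative lower limit.
  let Q : S × Act × Act → ℝ := fun x => (G.trans x.1 x.2.1 x.2.2).expect g
  let ψ : S × Act × Act → ℝ := fun x => r x.1 x.2.1 x.2.2 + Q x - (v + g x.1)
  have hψ : ∀ k h, 0 ≤ (G.nextRound σ₁ σ₂ k h).expect ψ := by
    intro k h
    rw [expect_nextRound]
    refine PMF.le_expect _ fun s => ?_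
    rw [expect_turn]
    simp only [ψ, Q, PMF.expect_sub_const]
    exact sub_nonneg.2 (hv _ _ _)
  filter_upwards [G.ae_tendsto_sum_sub_expect_nextRound_div σ₁ σ₂ s ψ,
    G.ae_tendsto_sum_sub_expect_nextRound_div σ₁ σ₂ s fun x => g x.1] with ω h₁ h₂
  simp only [expect_nextRound_fst] at h₂
  have hlow : ∀ T : ℕ, 1 ≤ T →
      v + ((∑ k ∈ Finset.range T, (ψ (ω (k + 1)) -
          (G.nextRound σ₁ σ₂ k fun i => ω i).expect ψ)) / T +
        (∑ k ∈ Finset.range T, (g (ω (k + 1)).1 - Q (ω k))) / T -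
        2 * (‖ψ‖ + ‖g‖) / T) ≤ avg r T ω := by
    intro T hT
    have hT' : (0 : ℝ) < T := by exact_mod_cast hT
    have e₁ : ∑ k ∈ Finset.range T, r (ω k).1 (ω k).2.1 (ω k).2.2 =
        T * v + (∑ k ∈ Finset.range T, ψ (ω k)) + (g (ω 0).1 - g (ω T).1) +
          ∑ k ∈ Finset.range T, (g (ω (k + 1)).1 - Q (ω k)) := by
      have hr : ∀ k, r (ω k).1 (ω k).2.1 (ω k).2.2 = v + ψ (ω k) +
          (g (ω k).1 - g (ω (k + 1)).1) + (g (ω (k + 1)).1 - Q (ω k)) := fun k => by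
        simp only [ψ]; ring
      rw [Finset.sum_congr rfl fun k _ => hr k, Finset.sum_add_distrib, Finset.sum_add_distrib,
        Finset.sum_add_distrib, Finset.sum_range_sub' (fun k => g (ω k).1), Finset.sum_const,
        Finset.card_range, nsmul_eq_mul]
    -- The strong law controls rounds 1 to `T`, the average uses rounds 0 to `T - 1`; this shift and
    -- the telescoping of `g` cost the boundary term `2 * (‖ψ‖ + ‖g‖)`.
    have e₂ : ∑ k ∈ Finset.range T, ψ (ω k) =
        ∑ k ∈ Finset.range T, ψ (ω (k + 1)) + (ψ (ω 0) - ψ (ω T)) := by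
      rw [← Finset.sum_range_sub' (fun k => ψ (ω k)) T, ← Finset.sum_add_distrib]
      exact Finset.sum_congr rfl fun k _ => by ring
    have e₃ : ∑ k ∈ Finset.range T, (ψ (ω (k + 1)) -
        (G.nextRound σ₁ σ₂ k fun i => ω i).expect ψ) ≤ ∑ k ∈ Finset.range T, ψ (ω (k + 1)) :=
      Finset.sum_le_sum fun k _ => sub_le_self _ (hψ _ _)
    have b₁ := abs_le.1 (norm_le_pi_norm ψ (ω 0))
    have b₂ := abs_le.1 (norm_le_pi_norm ψ (ω T))
    have b₃ := abs_le.1 (norm_le_pi_norm g (ω 0).1)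
    have b₄ := abs_le.1 (norm_le_pi_norm g (ω T).1)
    rw [avg, one_div, le_inv_mul_iff₀ hT', e₁]
    have e₄ : ∀ x y z : ℝ, T * (v + (x / T + y / T - z / T)) = T * v + x + y - z := by
      intro x y z
      field_simp
      ring
    rw [e₄]
    linarith [b₁.1, b₂.2, b₃.1, b₄.2]
  have hlim := (tendsto_const_nhds (x := v)).add ((h₁.add h₂).sub
    (tendsto_const_div_atTop_nhds_zero_nat (2 * (‖ψ‖ + ‖g‖))))
  simp only [add_zero, sub_zero] at hlim
  rw [← hlim.liminf_eq]
  exact liminf_le_liminf ((eventually_ge_atTop 1).mono hlow) hlim.isBoundedUnder_ge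
    (isBoundedUnder_le_avg r ω).isCoboundedUnder_ge

lemma le_expLimInfAvg {v : ℝ} {g : S → ℝ}
    (hv : ∀ k h s, v + g s ≤ (σ₁.move k h s).expect fun a => (σ₂.move k h s).expect fun b =>
      r s a b + (G.trans s a b).expect g) (s : S) :
    v ≤ G.expLimInfAvg r σ₁ σ₂ s := by
  have h := integral_mono_ae (integrable_const v) (integrable_limInfAvg r G σ₁ σ₂ s)
    (ae_le_limInfAvg hv s)
  simpa [expLimInfAvg] using h

end Averages

/-! ### From the optimality equation to the value. -/

section Values

variable {S Act : Type*} [Fintype S] [Fintype Act] [MeasurableSpace S]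
  [MeasurableSingletonClass S] [MeasurableSpace Act] [MeasurableSingletonClass Act]
  {G : GameStructure S Act} {r : S → Act → Act → ℝ} {v : ℝ}
  {g : S → ℝ} {x y : S → PMF Act}

/-- In a solution of the optimality equation, Player 1 guarantees `v`. -/
lemma le_expLimInfAvg_stationary (hsol : IsAverageSolution G.trans r v g x y)
    (hx : ∀ s, (x s).support ⊆ (G.moves₁ s : Set Act)) (σ₂ : G.Strategy₂) (s : S) :
    v ≤ G.expLimInfAvg r (Strategy.stationary x hx) σ₂ s := by
  refine le_expLimInfAvg (g := g) (fun k h s => ?_) s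
  rw [PMF.expect_comm]
  exact PMF.le_expect _ fun b => hsol.le_left s b

/-- In a solution of the optimality equation, Player 2 guarantees `-v` with the reward `-r`. -/
lemma le_expLimInfAvg_neg_stationary (hsol : IsAverageSolution G.trans r v g x y)
    (hy : ∀ s, (y s).support ⊆ (G.moves₂ s : Set Act)) (σ₁ : G.Strategy₁) (s : S) :
    -v ≤ G.expLimInfAvg (fun s a b => -r s a b) σ₁ (Strategy.stationary y hy) s := by
  refine le_expLimInfAvg (g := fun s => -g s) (fun k h s => ?_) s
  refine PMF.le_expect _ fun a => ?_
  have h := hsol.right_le s a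
  simp only [PMF.expect_neg, ← neg_add]
  exact neg_le_neg h

/-- A solution of the optimality equation whose stationary strategies are legal yields the value of
the mean-payoff game. -/
theorem hasValue_of_isAverageSolution (hsol : IsAverageSolution G.trans r v g x y)
    (hx : ∀ s, (x s).support ⊆ (G.moves₁ s : Set Act))
    (hy : ∀ s, (y s).support ⊆ (G.moves₂ s : Set Act)) (s : S) : G.HasValue r s v := by
  obtain ⟨R, hR⟩ := exists_abs_reward_le r
  let τ₁ : G.Strategy₁ := Strategy.stationary x hx
  let τ₂ : G.Strategy₂ := Strategy.stationary y hy
  have hτ₁ : ∀ σ₂, v ≤ G.expLimInfAvg r τ₁ σ₂ s := fun σ₂ =>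
    le_expLimInfAvg_stationary hsol hx σ₂ s
  have hτ₂ : ∀ σ₁, G.expLimSupAvg r σ₁ τ₂ s ≤ v := fun σ₁ => by
    have h := le_expLimInfAvg_neg_stationary hsol hy σ₁ s
    rw [expLimInfAvg_neg] at h
    exact neg_le_neg_iff.1 h
  have : Nonempty G.Strategy₁ := ⟨τ₁⟩
  have : Nonempty G.Strategy₂ := ⟨τ₂⟩
  -- Real suprema and infima of unbounded families take the default value 0, so boundedness has to
  -- be supplied.
  have hinf : ∀ σ₁, BddBelow (Set.range fun σ₂ => G.expLimInfAvg r σ₁ σ₂ s) := fun σ₁ =>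
    ⟨-R, Set.forall_mem_range.2 fun σ₂ => (abs_le.1 (abs_expLimInfAvg_le G σ₁ σ₂ hR s)).1⟩
  have hsup : ∀ σ₂, BddAbove (Set.range fun σ₁ => G.expLimSupAvg r σ₁ σ₂ s) := fun σ₂ =>
    ⟨R, Set.forall_mem_range.2 fun σ₁ => (abs_le.1 (abs_expLimSupAvg_le G σ₁ σ₂ hR s)).2⟩
  have hle : ∀ σ₁, ⨅ σ₂, G.expLimInfAvg r σ₁ σ₂ s ≤ v := fun σ₁ =>
    (ciInf_le (hinf σ₁) τ₂).trans ((expLimInfAvg_le_expLimSupAvg r G σ₁ τ₂ s).trans (hτ₂ σ₁))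
  have hge : ∀ σ₂, v ≤ ⨆ σ₁, G.expLimSupAvg r σ₁ σ₂ s := fun σ₂ =>
    ((hτ₁ σ₂).trans (expLimInfAvg_le_expLimSupAvg r G τ₁ σ₂ s)).trans (le_ciSup (hsup σ₂) τ₁)
  constructor
  · exact le_antisymm (ciSup_le hle)
      (le_ciSup_of_le ⟨v, Set.forall_mem_range.2 hle⟩ τ₁ (le_ciInf hτ₁))
  · exact le_antisymm
      (ciInf_le_of_le ⟨v, Set.forall_mem_range.2 hge⟩ τ₂ (ciSup_le hτ₂)) (le_ciInf hge)

end Values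

/-! ### Ergodicity from uniform reachability. -/

section Ergodicity

variable {S Act : Type*} [Fintype S] [Fintype Act] [MeasurableSpace S]
  [MeasurableSingletonClass S] [MeasurableSpace Act] [MeasurableSingletonClass Act]
  {G : GameStructure S Act}

/-- If every state can be approached with a probability bounded below, whatever the players do, then
the game is ergodic. -/
theorem isErgodic_of_uniformlyReachable {δ : ℝ} (hδ : 0 < δ)
    (hG : UniformlyReachable G.trans δ) : G.IsErgodic := by
  intro s t σ₁ σ₂
  obtain ⟨d, hd₀, hd⟩ := hG t
  let f : ℕ → S → ℝ := fun m s => if d s ≤ m then 1 else 0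
  have hf₀ : ∀ m s, 0 ≤ f m s := fun m s => by simp only [f]; split_ifs <;> norm_num
  have hf₁ : ∀ m s, f m s ≤ 1 := fun m s => by simp only [f]; split_ifs <;> norm_num
  have hstep : ∀ m s a b, δ * f (m + 1) s ≤ (G.trans s a b).expect (f m) := by
    intro m s a b
    by_cases hs : d s ≤ m + 1
    · obtain ⟨s', hs', hδs⟩ := hd s a b
      have h₁ : f m s' = 1 := if_pos (by omega)
      have h₂ : f (m + 1) s = 1 := if_pos hs
      rw [h₂, mul_one]
      refine hδs.trans ?_
      have := Finset.single_le_sum (f := fun u => (G.trans s a b u).toReal * f m u)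
        (fun u _ => mul_nonneg ENNReal.toReal_nonneg (hf₀ m u)) (Finset.mem_univ s')
      simpa only [h₁, mul_one, PMF.expect] using this
    · have h₂ : f (m + 1) s = 0 := if_neg hs
      rw [h₂, mul_zero]
      exact PMF.le_expect _ (hf₀ m)
  have hslln := ae_all_iff.2 fun m =>
    G.ae_tendsto_sum_sub_expect_nextRound_div σ₁ σ₂ s fun x => f m x.1
  filter_upwards [hslln] with ω hω
  simp only [expect_nextRound_fst] at hω
  -- The level `∑ s, d s` contains all states and so has density 1. Each step lowers the level by
  -- one; the truncated subtraction stops at level 0, which consists of at most `t`.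
  have hdensity : ∀ j, ∃ c : ℝ, 0 < c ∧ ∀ᶠ T : ℕ in atTop,
      c * T ≤ ∑ k ∈ Finset.range T, f (∑ s, d s - j) (ω k).1 := by
    intro j
    induction j with
    | zero =>
      refine ⟨1, one_pos, Eventually.of_forall fun T => ?_⟩
      have h : ∀ s, f (∑ s, d s - 0) s = 1 := fun s =>
        if_pos (Finset.single_le_sum (f := d) (fun _ _ => Nat.zero_le _) (Finset.mem_univ s))
      rw [Finset.sum_congr rfl fun k _ => h (ω k).1]
      simp
    | succ j ih =>
      obtain ⟨c, hc, hcT⟩ := ih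
      rcases Nat.eq_zero_or_pos (∑ s, d s - j) with h0 | hpos
      · rw [show ∑ s, d s - (j + 1) = ∑ s, d s - j by omega]
        exact ⟨c, hc, hcT⟩
      obtain ⟨m, hm⟩ := Nat.exists_eq_add_of_lt hpos
      rw [zero_add] at hm
      rw [hm] at hcT
      rw [show ∑ s, d s - (j + 1) = m by omega]
      -- Visits to level `m + 1` with density `c` lead to level `m` with density `c * δ` on average;
      -- half of it absorbs the fluctuation and the index shift.
      refine ⟨c * δ / 2, by positivity, ?_⟩
      have hlim := (hω m).sub (tendsto_const_div_atTop_nhds_zero_nat (1 : ℝ))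
      rw [sub_zero] at hlim
      have hneg : -(c * δ / 2) < 0 := by simpa using by positivity
      filter_upwards [hcT, hlim.eventually (lt_mem_nhds hneg), eventually_ge_atTop 1]
        with T hT hT₁ hT₂
      have hT' : (0 : ℝ) < T := by exact_mod_cast hT₂
      rw [← sub_div, lt_div_iff₀ hT', Finset.sum_sub_distrib] at hT₁
      have e₁ : ∑ k ∈ Finset.range T, f m (ω (k + 1)).1 - 1 ≤ ∑ k ∈ Finset.range T, f m (ω k).1 := by
        have h := Finset.sum_range_succ' (fun k => f m (ω k).1) T
        rw [Finset.sum_range_succ] at h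
        linarith [hf₀ m (ω 0).1, hf₁ m (ω T).1]
      have e₂ : δ * ∑ k ∈ Finset.range T, f (m + 1) (ω k).1 ≤ ∑ k ∈ Finset.range T,
          (G.trans (ω k).1 (ω k).2.1 (ω k).2.2).expect (f m) := by
        rw [Finset.mul_sum]
        exact Finset.sum_le_sum fun k _ => hstep _ _ _ _
      have e₃ := mul_le_mul_of_nonneg_left hT hδ.le
      have e₄ : ∑ k ∈ Finset.range T,
          (G.trans (ω k).1 (ω k).2.1 (ω k).2.2).expect (f m) = ∑ k ∈ Finset.range T,
          (G.trans (ω ((Fin.last k : Fin (k + 1)) : ℕ)).1 (ω ((Fin.last k : Fin (k + 1)) : ℕ)).2.1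
            (ω ((Fin.last k : Fin (k + 1)) : ℕ)).2.2).expect (f m) := rfl
      linarith
  obtain ⟨c, hc, hcT⟩ := hdensity (∑ s, d s)
  rw [Nat.sub_self] at hcT
  -- Finitely many visits to `t` would bound the number of visits to level 0, against its linear
  -- growth.
  by_contra hfreq
  obtain ⟨K, hK⟩ := eventually_atTop.1 (not_frequently.1 hfreq)
  have hzero : ∀ k, K ≤ k → f 0 (ω k).1 = 0 := fun k hk =>
    if_neg fun h => hK k hk (hd₀ _ (Nat.le_zero.1 h))
  have hsum : ∀ T, K ≤ T → ∑ k ∈ Finset.range T, f 0 (ω k).1 ≤ K := by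
    intro T hT
    rw [← Finset.sum_range_add_sum_Ico _ hT, Finset.sum_eq_zero (s := Finset.Ico K T)
      fun k hk => hzero k (Finset.mem_Ico.1 hk).1, add_zero]
    refine (Finset.sum_le_card_nsmul _ _ _ fun k _ => hf₁ 0 _).trans_eq ?_
    simp
  obtain ⟨T, hT₁, hT₂, hT₃⟩ := (hcT.and ((eventually_ge_atTop K).and
    ((tendsto_natCast_atTop_atTop.const_mul_atTop hc).eventually_gt_atTop (K : ℝ)))).exists
  exact absurd (hT₁.trans (hsum T hT₂)) (not_le.2 hT₃)

end Ergodicity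

end GameStructure

end ConcurrentGame

end

/-! ### The proof-of-stake arena: reachability and symmetry. -/

lemma PMF.mul_toReal_le_bind_apply {α β : Type*} (p : PMF α) (f : α → PMF β) (a : α) (b : β) :
    (p a).toReal * (f a b).toReal ≤ (p.bind f b).toReal := by
  rw [← ENNReal.toReal_mul]
  refine ENNReal.toReal_mono (PMF.apply_ne_top _ _) ?_
  rw [PMF.bind_apply]
  exact ENNReal.le_tsum (f := fun a => p a * f a b) a

lemma PMF.toReal_le_map_apply {α β : Type*} (p : PMF α) (f : α → β) (a : α) :
    (p a).toReal ≤ (p.map f (f a)).toReal := by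
  have h := p.mul_toReal_le_bind_apply (PMF.pure ∘ f) a (f a)
  rwa [PMF.bind_pure_comp, Function.comp_apply, PMF.pure_apply_self, ENNReal.toReal_one,
    mul_one] at h

namespace ProofOfStake

open ConcurrentGame GameStructure StochasticGame

variable {n : ℕ} (law : SignatureLaw)

lemma one_sixth_le_changeLaw (most : Prop) (c : Change) : 1 / 6 ≤ (changeLaw most c).toReal := by
  rw [changeLaw, PMF.ofFintype_apply, ENNReal.coe_toReal]
  by_cases h : most <;> cases c <;> simp only [changeWeight, h, if_true, if_false] <;>
    norm_num

lemma one_third_le_connectivityLaw {k k' : Fin 101} (h₁ : (k' : ℕ) ≤ k + 1)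
    (h₂ : (k : ℕ) ≤ k' + 1) :
    1 / 3 ≤ (connectivityLaw k k').toReal := by
  have hcard : (Finset.univ.filter fun k' : Fin 101 =>
      (k' : ℕ) ≤ (k : ℕ) + 1 ∧ (k : ℕ) ≤ (k' : ℕ) + 1).card ≤ 3 := by
    refine (Finset.card_le_card_of_injOn (t := Finset.Icc ((k : ℕ) - 1) (k + 1))
      (fun k' : Fin 101 => (k' : ℕ)) (fun l hl => ?_) Fin.val_injective.injOn).trans ?_
    · have := (Finset.mem_filter.1 hl).2
      exact Finset.mem_coe.2 (Finset.mem_Icc.2 ⟨by dsimp only; omega, by dsimp only; omega⟩)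
    · rw [Nat.card_Icc]
      omega
  have happly : connectivityLaw k k' = _ :=
    PMF.uniformOfFinset_apply_of_mem _ (Finset.mem_filter.2 ⟨Finset.mem_univ _, h₁, h₂⟩)
  rw [happly, ENNReal.toReal_inv, ENNReal.toReal_natCast, one_div]
  refine inv_anti₀ ?_ (by exact_mod_cast hcard)
  exact_mod_cast Finset.card_pos.2 ⟨k, by simp⟩

/-- Independence multiplies the bounds 1/6, 1/6 and 1/3. Stakes are indexed by changes because at
the boundary several changes give the same stake, which only adds probability. -/
lemma one_div_108_le_transition (s : State n) (a b : Move) (c d : Change) {k : Fin 101}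
    (h₁ : (k : ℕ) ≤ s.2.2 + 1) (h₂ : (s.2.2 : ℕ) ≤ k + 1) :
    1 / 108 ≤ (transition law s a b (applyChange s.1 c, applyChange s.2.1 d, k)).toReal := by
  set most := attrA law s a b ≤ attrB law s a b
  have h₃ := (one_third_le_connectivityLaw h₁ h₂).trans (PMF.toReal_le_map_apply _
    (fun k => (applyChange s.1 c, applyChange s.2.1 d, k)) k)
  have h₄ := (mul_le_mul (one_sixth_le_changeLaw most d) h₃ (by norm_num)
    ENNReal.toReal_nonneg).trans (PMF.mul_toReal_le_bind_apply _ (fun d =>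
      (connectivityLaw s.2.2).map fun k => (applyChange s.1 c, applyChange s.2.1 d, k)) d _)
  have h₅ := (mul_le_mul (one_sixth_le_changeLaw (attrB law s a b ≤ attrA law s a b) c) h₄
    (by norm_num) ENNReal.toReal_nonneg).trans (PMF.mul_toReal_le_bind_apply _ (fun c =>
      (changeLaw most).bind fun d =>
        (connectivityLaw s.2.2).map fun k => (applyChange s.1 c, applyChange s.2.1 d, k)) c _)
  exact le_trans (by norm_num) h₅

/-- With truncated subtraction, `(i - t) + (t - i)` is the distance |i - t|. A move towards `t`
never leaves the range, so the boundary rule does not interfere. -/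
lemma exists_applyChange_closer (i t : Fin n) : ∃ c : Change,
    ((applyChange i c : ℕ) - t) + (t - applyChange i c) ≤ ((i : ℕ) - t) + (t - i) - 1 := by
  rcases lt_trichotomy (i : ℕ) t with h | h | h
  · refine ⟨Change.gain, ?_⟩
    have hi : (i : ℕ) + 1 < n := by omega
    simp only [applyChange, hi, dif_pos]
    omega
  · exact ⟨Change.keep, by simp only [applyChange]; omega⟩
  · exact ⟨Change.lose, by simp only [applyChange]; omega⟩

lemma exists_connectivity_closer (k t : Fin 101) : ∃ k' : Fin 101, (k' : ℕ) ≤ k + 1 ∧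
    (k : ℕ) ≤ k' + 1 ∧ ((k' : ℕ) - t) + (t - k') ≤ ((k : ℕ) - t) + (t - k) - 1 := by
  rcases lt_trichotomy (k : ℕ) t with h | h | h
  · exact ⟨⟨k + 1, by omega⟩, by simp only; omega, by simp only; omega, by simp only; omega⟩
  · exact ⟨k, by omega, by omega, by omega⟩
  · exact ⟨⟨k - 1, by omega⟩, by simp only; omega, by simp only; omega, by simp only; omega⟩

theorem uniformlyReachable_game :
    UniformlyReachable (game n law).trans (1 / 108) := by
  rintro ⟨i', j', k'⟩
  -- The ℓ¹ distance to the target: all coordinates that are off approach it in the same round.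
  refine ⟨fun s => ((s.1 : ℕ) - i') + (i' - s.1) + (((s.2.1 : ℕ) - j') + (j' - s.2.1)) +
    (((s.2.2 : ℕ) - k') + (k' - s.2.2)), ?_, ?_⟩
  · rintro ⟨i, j, k⟩ h
    simp only at h
    simp only [Prod.mk.injEq, Fin.ext_iff]
    omega
  · rintro ⟨i, j, k⟩ a b
    obtain ⟨c, hc⟩ := exists_applyChange_closer i i'
    obtain ⟨d, hd⟩ := exists_applyChange_closer j j'
    obtain ⟨l, hl₁, hl₂, hl⟩ := exists_connectivity_closer k k'
    refine ⟨(applyChange i c, applyChange j d, l), ?_,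
      one_div_108_le_transition law _ a b c d hl₁ hl₂⟩
    simp only
    omega

/-- The state in which the two pools have exchanged their roles. -/
def State.swap (s : State n) : State n := (s.2.1, s.1, s.2.2)

/-- The rule for gains and losses treats the pools alike, and their changes are independent, so the
order of the two draws can be exchanged. -/
lemma expect_transition_swap (s : State n) (a b : Move) (f : State n → ℝ) :
    (transition law s.swap b a).expect f = (transition law s a b).expect fun s => f s.swap := by
  simp only [transition, PMF.expect_bind, PMF.expect_map]
  rw [PMF.expect_comm]
  rfl

/-- The symmetry of the game turns a solution of the optimality equation for the revenue of `A` into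
one for the revenue of `B`. -/
lemma isAverageSolution_neg_revenueB {v : ℝ} {h : State n → ℝ} {x y : State n → PMF Move}
    (hsol : IsAverageSolution (game n law).trans (revenueA law) v h x y) :
    IsAverageSolution (game n law).trans (fun s a b => -revenueB law s a b) (-v)
      (fun s => -h s.swap) (fun s => y s.swap) (fun s => x s.swap) := by
  have key : ∀ (s : State n) a b, -revenueB law s a b +
      ((game n law).trans s a b).expect (fun s => -h s.swap) =
        -(revenueA law s.swap b a + ((game n law).trans s.swap b a).expect h) := by
    intro s a b
    have e := expect_transition_swap law s a b h
    simp only [game, PMF.expect_neg, e, neg_add]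
    rfl
  constructor
  · intro s b
    simp only [key]
    simp only [PMF.expect_neg, ← neg_add]
    exact neg_le_neg (hsol.right_le s.swap b)
  · intro s a
    simp only [key]
    simp only [PMF.expect_neg, ← neg_add]
    exact neg_le_neg (hsol.le_left s.swap a)

end ProofOfStake

theorem theorem3 (n : ℕ) (hn : 1 ≤ n) (law : ProofOfStake.SignatureLaw) :
    (ProofOfStake.game n law).IsErgodic ∧
    ∃ v : ℝ,
      (∀ s, (ProofOfStake.game n law).HasValue (ProofOfStake.revenueA law) s v) ∧
      (∀ s, (ProofOfStake.game n law).HasValue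
        (fun s a b => -ProofOfStake.revenueB law s a b) s (-v)) ∧
      ∃ σB : (ProofOfStake.game n law).Strategy₂,
        ∀ (σA : (ProofOfStake.game n law).Strategy₁) (s : ProofOfStake.State n),
          v ≤ (ProofOfStake.game n law).expLimInfAvg (ProofOfStake.revenueB law) σA σB s := by
  have hδ : (0 : ℝ) < 1 / 108 := by norm_num
  have hreach := ProofOfStake.uniformlyReachable_game (n := n) law
  -- Makes the state space nonempty, as the vanishing discount argument needs a reference state.
  have : NeZero n := ⟨by omega⟩
  have : Nonempty ProofOfStake.Move := ⟨ProofOfStake.Move.sign⟩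
  obtain ⟨v, h, x, y, hsol⟩ :=
    StochasticGame.exists_isAverageSolution hδ hreach (ProofOfStake.revenueA law)
  have hsol' := ProofOfStake.isAverageSolution_neg_revenueB law hsol
  have h₁ : ∀ (z : ProofOfStake.State n → PMF ProofOfStake.Move) s,
      (z s).support ⊆ ((ProofOfStake.game n law).moves₁ s : Set ProofOfStake.Move) :=
    fun z s a _ => Finset.mem_coe.2 (Finset.mem_univ a)
  have h₂ : ∀ (z : ProofOfStake.State n → PMF ProofOfStake.Move) s,
      (z s).support ⊆ ((ProofOfStake.game n law).moves₂ s : Set ProofOfStake.Move) :=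
    fun z s a _ => Finset.mem_coe.2 (Finset.mem_univ a)
  refine ⟨ConcurrentGame.GameStructure.isErgodic_of_uniformlyReachable hδ hreach, v,
    ConcurrentGame.GameStructure.hasValue_of_isAverageSolution hsol (h₁ x) (h₂ y),
    ConcurrentGame.GameStructure.hasValue_of_isAverageSolution hsol' (h₁ _) (h₂ _),
    ConcurrentGame.Strategy.stationary _ (h₂ fun s => x s.swap), fun σA s => ?_⟩
  -- In the mirrored game B is the minimiser of -R_B with value -v; the two negations cancel to the
  -- guarantee v for R_B.
  have h := ConcurrentGame.GameStructure.le_expLimInfAvg_neg_stationary hsol' (h₂ _) σA s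
  simpa only [neg_neg] using h
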